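/- Let $Q$ be a smooth finite-dimensional manifold (Hausdorff, second countable) and let $G$ be a Lie group acting smoothly, freely and properly on $Q$ from the right, with Lie algebra $\mathfrak g$ and infinitesimal generators $\xi_Q(q)=\frac{d}{ds}\big|_{s=0}\,q\,g(s)$, where $g(0)=e$, $\dot g(0)=\xi$. Let $L:TQ\to\mathbb R$ be smooth, and let $F:TQ\to T^*Q$ be a smooth map fibred over the identity (a force term). A smooth curve $q:[a,b]\to Q$, $a<b$, is called critical for $(Q,L,F)$ if $$\frac{d}{d\varepsilon}\Big|_{\varepsilon=0}\int_a^b L(\dot q_\varepsilon(t))\,dt+\int_a^b\langle F(\dot q(t)),\delta q(t)\rangle\,dt=0$$ for all smooth deformations $q_\varepsilon$ of $q=q_0$ with fixed endpoints, where $\delta q=\partial_\varepsilon q_\varepsilon|_{\varepsilon=0}$. The momentum map $J_L:TQ\to\mathfrak g^*$ is $J_L(v_q)(\xi)=\frac{d}{d\varepsilon}\big|_{\varepsilon=0}L(v_q+\varepsilon\,\xi_Q(q))$, and $(Q,L,F)$ is said to have conserved momentum with respect to $G$ if $t\mapsto J_L(\dot q(t))$ is constant along each critical curve $q$. A force term $F$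 is gyroscopic, associated to a closed 2-form $\beta$, if $F(v)=-i_v\beta$. Assume that $(Q,L,F)$ is $G$-invariant: $L(v_qg)=L(v_q)$, $\langle F(v_qg),w_qg\rangle=\langle F(v_q),w_q\rangle$ and $\langle F(v_q),\xi_Q(q)\rangle=0$ for all $g\in G$, $v_q,w_q\in T_qQ$ and $\xi\in\mathfrak g$. Let $\omega$ be a principal connection, i.e. a smooth $\mathfrak g$-valued 1-form on $Q$ with $\omega(\xi_Q)=\xi$ and $R_g^*\omega=\mathrm{Ad}_{g^{-1}}\omega$, and let $\mu\in\mathfrak g^*$. Put $\omega^\mu=\langle\mu,\omega\rangle$, let $R^\mu(v_q)=L(v_q)-\langle\mu,\omega(q)(v_q)\rangle$ be the Routhian, and let $G^\mu(v_q)=-i_{v_q}d\omega^\mu=-\langle\mu,i_{v_q}d\omega\rangle$, the gyroscopic force term associated to the closed 2-form $d\omega^\mu$. Then: 1. A curve is critical for $(Q,L,F)$ if and only if it is critical for $(Q,R^\mu,F+G^\mu)$. 2. The system $(Q,R^\mu,F+G^\mu)$ has conserved momentum $J_{R^\mu}$ with respect to the entire group $G$. 3. $J_{R^\mu}=J_L-\mu$.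 Hence $q(t)$ is a critical curve of $(Q,L,F)$ with momentum $J_L(\dot q(t))=\mu$ if and only if $q(t)$ is a critical curve of $(Q,R^\mu,F+G^\mu)$ with momentum $J_{R^\mu}(\dot q(t))=0$. -/

import Mathlib

open Set MeasureTheory
open scoped Manifold ContDiff RightActions

noncomputable section

namespace Routh

section Manifold

variable {E : Type*} [NormedAddCommGroup E] [NormedSpace ℝ E]
  {Q : Type*} [TopologicalSpace Q] [ChartedSpace E Q]

/-! ### Lagrangian systems and critical curves -/

/-- A force term `F : TQ → T*Q` fibred over the identity of `Q`. -/
abbrev ForceTerm (E Q : Type*) [NormedAddCommGroup E] [NormedSpace ℝ E]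
    [TopologicalSpace Q] [ChartedSpace E Q] : Type _ :=
  ∀ v : TangentBundle 𝓘(ℝ, E) Q, TangentSpace 𝓘(ℝ, E) v.proj →L[ℝ] ℝ

/-- Smoothness of a Lagrangian `L : TQ → ℝ`. -/
def SmoothLagrangian (L : TangentBundle 𝓘(ℝ, E) Q → ℝ) [IsManifold 𝓘(ℝ, E) ∞ Q] : Prop :=
  ContMDiff 𝓘(ℝ, E).tangent 𝓘(ℝ, ℝ) ∞ L

/-- Smoothness of a force term, as a map from `TQ` to the total space of `T*Q`. -/
def SmoothForceTerm (F : ForceTerm E Q) [IsManifold 𝓘(ℝ, E) ∞ Q] : Prop :=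
  ContMDiff 𝓘(ℝ, E).tangent (𝓘(ℝ, E).prod 𝓘(ℝ, E →L[ℝ] ℝ)) ∞
    (fun v : TangentBundle 𝓘(ℝ, E) Q ↦
      Bundle.TotalSpace.mk' (E →L[ℝ] ℝ) (E := fun q : Q ↦ TangentSpace 𝓘(ℝ, E) q →L[ℝ] ℝ) v.proj (F v))

/-- The curve `t ↦ q̇(t)` in `TQ` of a curve `q : [a, b] → Q` (one-sided derivatives at `a`, `b`).
Curves on `[a, b]` are functions on `ℝ` of which only the values on `[a, b]` matter. -/
def velocity (a b : ℝ) (q : ℝ → Q) (t : ℝ) : TangentBundle 𝓘(ℝ, E) Q :=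
  ⟨q t, mfderivWithin 𝓘(ℝ, ℝ) 𝓘(ℝ, E) q (Icc a b) t (1 : ℝ)⟩

/-- `c ε t` is a smooth deformation, with fixed endpoints, of the curve `q : [a, b] → Q`. -/
def IsVariation (E : Type*) [NormedAddCommGroup E] [NormedSpace ℝ E]
    {Q : Type*} [TopologicalSpace Q] [ChartedSpace E Q]
    (a b : ℝ) (q : ℝ → Q) (c : ℝ → ℝ → Q) : Prop :=
  (∀ t ∈ Icc a b, c 0 t = q t) ∧
  ∃ δ > 0,
    ContMDiffOn 𝓘(ℝ, ℝ × ℝ) 𝓘(ℝ, E) ∞ (fun p : ℝ × ℝ ↦ c p.1 p.2) (Ioo (-δ) δ ×ˢ Icc a b) ∧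
    ∀ ε ∈ Ioo (-δ) δ, c ε a = q a ∧ c ε b = q b

/-- The infinitesimal variation `δq(t) = ∂c/∂ε (0, t)` of a deformation `c`. -/
def infVariation (c : ℝ → ℝ → Q) (t : ℝ) : TangentSpace 𝓘(ℝ, E) (c 0 t) :=
  mfderiv 𝓘(ℝ, ℝ) 𝓘(ℝ, E) (fun ε ↦ c ε t) 0 (1 : ℝ)

/-- The smooth curve `q : [a, b] → Q` is critical for `(Q, L, F)`:
`δ ∫ L(q̇) dt + ∫ ⟨F(q̇), δq⟩ dt = 0` for all variations with fixed endpoints, where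
`δ ∫ L(q̇) dt` is the derivative at `ε = 0` of the action of the deformed curve. -/
def IsCriticalCurve (L : TangentBundle 𝓘(ℝ, E) Q → ℝ) (F : ForceTerm E Q)
    (a b : ℝ) (q : ℝ → Q) : Prop :=
  ContMDiffOn 𝓘(ℝ, ℝ) 𝓘(ℝ, E) ∞ q (Icc a b) ∧
  ∀ c : ℝ → ℝ → Q, IsVariation E a b q c →
    HasDerivAt (fun ε ↦ ∫ t in a..b, L (velocity a b (c ε) t))
      (-∫ t in a..b, F (velocity a b (c 0) t) (infVariation c t)) 0

/-! ### Differential forms and gyroscopic forces -/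

/-- `V`-valued `n`-forms on `Q` (no regularity is imposed here). -/
abbrev Form (E Q V : Type*) [NormedAddCommGroup E] [NormedSpace ℝ E] [TopologicalSpace Q]
    [ChartedSpace E Q] [AddCommGroup V] [Module ℝ V] [TopologicalSpace V] (n : ℕ) : Type _ :=
  ∀ x : Q, TangentSpace 𝓘(ℝ, E) x [⋀^Fin n]→L[ℝ] V

/-- The local representative of a form in the chart `φ` at `x₀`, i.e. its pull-back by `φ⁻¹`. -/
def Form.inChart {V : Type*} [NormedAddCommGroup V] [NormedSpace ℝ V] {n : ℕ}
    (α : Form E Q V n) (x₀ : Q) (y : E) : E [⋀^Fin n]→L[ℝ] V :=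
  (α ((extChartAt 𝓘(ℝ, E) x₀).symm y)).compContinuousLinearMap
    (mfderiv 𝓘(ℝ, E) 𝓘(ℝ, E) (extChartAt 𝓘(ℝ, E) x₀).symm y)

/-- The exterior derivative of a form: at `x` it is the pull-back, by the chart at `x`, of the
exterior derivative of the local representative. For one-forms this is normalised by
`dα(X, Y) = X(α(Y)) - Y(α(X)) - α([X, Y])`. -/
def Form.d {V : Type*} [NormedAddCommGroup V] [NormedSpace ℝ V] {n : ℕ}
    (α : Form E Q V n) : Form E Q V (n + 1) := fun x ↦
  (extDeriv (α.inChart x) (extChartAt 𝓘(ℝ, E) x x)).compContinuousLinearMap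
    (mfderiv 𝓘(ℝ, E) 𝓘(ℝ, E) (extChartAt 𝓘(ℝ, E) x) x)

/-- A field of linear maps `T_qQ → V`, regarded as a `V`-valued 1-form. -/
def oneForm {V : Type*} [NormedAddCommGroup V] [NormedSpace ℝ V]
    (α : ∀ q : Q, TangentSpace 𝓘(ℝ, E) q →L[ℝ] V) : Form E Q V 1 := fun q ↦
  ContinuousAlternatingMap.ofSubsingleton ℝ (TangentSpace 𝓘(ℝ, E) q) V (0 : Fin 1) (α q)

/-- `F` is the gyroscopic force term associated to the 2-form `β`: `β` is closed and
`F(v) = - i_v β`. -/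
def IsGyroscopicForce (F : ForceTerm E Q) (β : Form E Q ℝ 2) : Prop :=
  (∀ q, β.d q = 0) ∧ ∀ (q : Q) (v w : TangentSpace 𝓘(ℝ, E) q), F ⟨q, v⟩ w = - β q ![v, w]

/-- The force term `v ↦ - i_v β` of a 2-form `β`. -/
def gyroscopicForce (β : Form E Q ℝ 2) : ForceTerm E Q := fun v ↦
  - (β v.proj).toContinuousMultilinearMap.toContinuousLinearMap ![v.2, 0] 1

lemma gyroscopicForce_apply (β : Form E Q ℝ 2) (q : Q) (v w : TangentSpace 𝓘(ℝ, E) q) :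
    gyroscopicForce β ⟨q, v⟩ w = - β q ![v, w] := by
  have h : Function.update ![v, 0] 1 w = ![v, w] := by
    ext i; fin_cases i <;> simp
  simp only [gyroscopicForce, neg_apply]
  congr 1
  change β q (Function.update ![v, 0] 1 w) = _
  rw [h]

end Manifold

/-! ### Symmetry -/

/-! The Lie algebra `𝔤 = T_1 G` is modelled on the normed space `𝔼`, on which `G` is modelled. -/

section Symmetry

variable {E : Type*} [NormedAddCommGroup E] [NormedSpace ℝ E]
  {Q : Type*} [TopologicalSpace Q] [ChartedSpace E Q]
  {𝔼 : Type*} [NormedAddCommGroup 𝔼] [NormedSpace ℝ 𝔼]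
  {G : Type*} [TopologicalSpace G] [ChartedSpace 𝔼 G] [Group G] [MulAction Gᵐᵒᵖ Q]

/-- The infinitesimal action `ξ_Q(q) = σ_q(ξ)`, with `σ_q` the tangent map at the unit of
`g ↦ q g`. Its natural type `T_{q 1} Q` is `T_q Q`. -/
def infAction (E : Type*) [NormedAddCommGroup E] [NormedSpace ℝ E]
    {Q : Type*} [TopologicalSpace Q] [ChartedSpace E Q] [MulAction Gᵐᵒᵖ Q]
    (q : Q) (ξ : GroupLieAlgebra 𝓘(ℝ, 𝔼) G) : TangentSpace 𝓘(ℝ, E) q :=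
  (mfderiv 𝓘(ℝ, 𝔼) 𝓘(ℝ, E) (fun g : G ↦ q <• g) 1 ξ :)

/-- The tangent map `v ↦ v g` at `q` of the right translation `R_g : q ↦ q g`. -/
def rightTangent (E : Type*) [NormedAddCommGroup E] [NormedSpace ℝ E]
    {Q : Type*} [TopologicalSpace Q] [ChartedSpace E Q] [MulAction Gᵐᵒᵖ Q]
    (g : G) (q : Q) : TangentSpace 𝓘(ℝ, E) q →L[ℝ] TangentSpace 𝓘(ℝ, E) (q <• g) :=
  mfderiv 𝓘(ℝ, E) 𝓘(ℝ, E) (fun x : Q ↦ x <• g) q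

/-- The adjoint action on the Lie algebra, the tangent map at the unit of `h ↦ g h g⁻¹`. -/
def Ad (g : G) : GroupLieAlgebra 𝓘(ℝ, 𝔼) G →L[ℝ] GroupLieAlgebra 𝓘(ℝ, 𝔼) G :=
  (mfderiv 𝓘(ℝ, 𝔼) 𝓘(ℝ, 𝔼) (fun h : G ↦ g * h * g⁻¹) 1 :)

variable (𝔼 G) in
/-- Invariance of a Lagrangian under the lifted action of `G` on `TQ`. -/
def InvariantLagrangian (L : TangentBundle 𝓘(ℝ, E) Q → ℝ) : Prop :=
  ∀ (g : G) (q : Q) (v : TangentSpace 𝓘(ℝ, E) q), L ⟨q <• g, rightTangent E g q v⟩ = L ⟨q, v⟩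

variable (𝔼 G) in
/-- `G`-invariance of a force term. -/
def InvariantForceTerm (F : ForceTerm E Q) : Prop :=
  (∀ (g : G) (q : Q) (v w : TangentSpace 𝓘(ℝ, E) q),
    F ⟨q <• g, rightTangent E g q v⟩ (rightTangent E g q w) = F ⟨q, v⟩ w) ∧
  ∀ (q : Q) (v : TangentSpace 𝓘(ℝ, E) q) (ξ : GroupLieAlgebra 𝓘(ℝ, 𝔼) G),
    F ⟨q, v⟩ (infAction E q ξ) = 0

/-- The momentum map `J_L(v)(ξ) = d/dε|₀ L(v + ε ξ_Q)`. -/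
def momentumMap (L : TangentBundle 𝓘(ℝ, E) Q → ℝ) (v : TangentBundle 𝓘(ℝ, E) Q)
    (ξ : GroupLieAlgebra 𝓘(ℝ, 𝔼) G) : ℝ :=
  deriv (fun ε : ℝ ↦ L ⟨v.proj, v.2 + ε • infAction E v.proj ξ⟩) 0

variable (𝔼 G) in
/-- `(Q, L, F)` has conserved momentum with respect to `G`: the momentum map is constant along
each critical curve. -/
def HasConservedMomentum (L : TangentBundle 𝓘(ℝ, E) Q → ℝ) (F : ForceTerm E Q) : Prop :=
  ∀ (a b : ℝ) (q : ℝ → Q), a < b → IsCriticalCurve L F a b q →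
    ∀ s ∈ Icc a b, ∀ t ∈ Icc a b, ∀ ξ : GroupLieAlgebra 𝓘(ℝ, 𝔼) G,
      momentumMap L (velocity a b q s) ξ = momentumMap L (velocity a b q t) ξ

/-- A principal connection: a smooth Lie algebra valued one-form `A` with `A(ξ_Q) = ξ` and
`R_g^* A = Ad_{g⁻¹} A`. -/
structure IsPrincipalConnection [IsManifold 𝓘(ℝ, E) ∞ Q]
    (A : ∀ q : Q, TangentSpace 𝓘(ℝ, E) q →L[ℝ] GroupLieAlgebra 𝓘(ℝ, 𝔼) G) : Prop where
  smooth :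
    ContMDiff 𝓘(ℝ, E) (𝓘(ℝ, E).prod 𝓘(ℝ, E →L[ℝ] 𝔼)) ∞
      (fun q : Q ↦ Bundle.TotalSpace.mk' (E →L[ℝ] 𝔼)
        (E := fun q : Q ↦ TangentSpace 𝓘(ℝ, E) q →L[ℝ] 𝔼) q (A q))
  vertical : ∀ (q : Q) (ξ : GroupLieAlgebra 𝓘(ℝ, 𝔼) G), A q (infAction E q ξ) = ξ
  equivariant : ∀ (g : G) (q : Q) (v : TangentSpace 𝓘(ℝ, E) q),
    A (q <• g) (rightTangent E g q v) = Ad g⁻¹ (A q v)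

/-- The Routhian `R^μ(v) = L(v) - ⟨μ, A(v)⟩` of a connection `A`. -/
def routhian (L : TangentBundle 𝓘(ℝ, E) Q → ℝ)
    (A : ∀ q : Q, TangentSpace 𝓘(ℝ, E) q →L[ℝ] GroupLieAlgebra 𝓘(ℝ, 𝔼) G)
    (μ : GroupLieAlgebra 𝓘(ℝ, 𝔼) G →L[ℝ] ℝ) : TangentBundle 𝓘(ℝ, E) Q → ℝ :=
  fun v ↦ L v - μ (A v.proj v.2)

/-- The real-valued one-form `⟨μ, A⟩`. -/
def pairing (A : ∀ q : Q, TangentSpace 𝓘(ℝ, E) q →L[ℝ] GroupLieAlgebra 𝓘(ℝ, 𝔼) G)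
    (μ : GroupLieAlgebra 𝓘(ℝ, 𝔼) G →L[ℝ] ℝ) : Form E Q ℝ 1 :=
  oneForm fun q ↦ μ.comp (A q)

/-- The exterior derivative `dA` of a Lie algebra valued one-form `A`; as `𝔤 = T_1 G` is
the vector space `𝔼`, this is the exterior derivative of an `𝔼`-valued form. -/
def dConn (A : ∀ q : Q, TangentSpace 𝓘(ℝ, E) q →L[ℝ] GroupLieAlgebra 𝓘(ℝ, 𝔼) G)
    (q : Q) (v w : TangentSpace 𝓘(ℝ, E) q) : GroupLieAlgebra 𝓘(ℝ, 𝔼) G :=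
  ((oneForm (V := 𝔼) A).d q ![v, w] :)

/-- The gyroscopic force term `G^μ(v) = - i_v d⟨μ, A⟩`. -/
def gyroMu (A : ∀ q : Q, TangentSpace 𝓘(ℝ, E) q →L[ℝ] GroupLieAlgebra 𝓘(ℝ, 𝔼) G)
    (μ : GroupLieAlgebra 𝓘(ℝ, 𝔼) G →L[ℝ] ℝ) : ForceTerm E Q :=
  gyroscopicForce (pairing A μ).d

end Symmetry

end Routh

end

/-!
The Routhian `R^μ = L - ⟨μ, A⟩` differs from `L` by a function which is linear in the velocity,
that is, by the smooth one-form `α = ⟨μ, A⟩`. Everything rests on the first variation of the line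
integral of a one-form: along a deformation `c(ε, t)` with fixed endpoints,
`d/dε ∫ α(q̇) dt = ∫ dα(δq, q̇) dt` (`hasDerivAt_integral_oneForm`). Indeed, on the parameter strip
`(-δ, δ) × [a, b]` the pull-back of `dα` by `c` is the exterior derivative of the pull-back
(`Form.extDerivWithin_pullbackWithin`), which reads `dα(δq, q̇) = ∂_ε (α(q̇)) - ∂_t (α(δq))`, and
the last term integrates to zero. Hence the term subtracted from the action is compensated exactly
by the gyroscopic force `- i_v dα`, and the two systems have the same critical curves
(`isCriticalCurve_sub_oneForm_iff`).

Since `A(ξ_Q) = ξ`, the fibre derivative of `α` in the direction `ξ_Q` is `⟨μ, ξ⟩`, so that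
`J_{R^μ} = J_L - μ` (`momentumMap_sub`, `momentumMap_oneForm`). In general `R^μ` and the gyroscopic
force are invariant under the stabiliser of `μ` only, but conservation of `J_{R^μ}` with respect to
all of `G` follows from that of `J_L`, because the critical curves are the same and `μ` is constant.

Conservation of `J_L` is Noether's theorem (`hasConservedMomentum_of_invariant`). For a curve `γ` in
`G` with `γ(0) = 1` and `γ'(0) = ξ`, the deformation `q(t) γ(ε f(t))` has, by invariance,
`L = L(q̇ + ε f' ζ_Q(q))`, where `ζ = γ' γ⁻¹` is evaluated at `ε f(t)`; its `ε`-derivative at `0` is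
`f' J_L(q̇)(ξ)`. The infinitesimal variation is vertical, and the force vanishes on it. Criticality
therefore gives `∫ f' J dt = 0` whenever `f(a) = f(b) = 0`, and the choice `f' = J - m`, with `m`
the mean value of `J`, yields `∫ (J - m)² dt = 0`. This `f` is an admissible choice because
deformations are only required to be smooth on `[a, b]`, and because `J` is smooth there, which the
same formula shows with `f(t) = t`.
-/

noncomputable section

namespace Routh

theorem minSmoothness_two_le_infty : minSmoothness ℝ 2 ≤ (∞ : WithTop ℕ∞) := by
  rw [minSmoothness_of_isRCLikeNormedField]
  exact WithTop.coe_le_coe.2 le_top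

/-! ### Naturality of the exterior derivative -/

section Forms

variable {E : Type*} [NormedAddCommGroup E] [NormedSpace ℝ E]
  {Q : Type*} [TopologicalSpace Q] [ChartedSpace E Q]
  {V : Type*} [NormedAddCommGroup V] [NormedSpace ℝ V]
  {H : Type*} [NormedAddCommGroup H] [NormedSpace ℝ H] {n : ℕ}

/-- The pull-back `f^*α` of a form along a map `f` from a normed space, formed with derivatives
within `s` so that it makes sense up to the boundary of `s`. -/
def Form.pullbackWithin (α : Form E Q V n) (f : H → Q) (s : Set H) (p : H) : H [⋀^Fin n]→L[ℝ] V :=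
  (α (f p)).compContinuousLinearMap (mfderivWithin 𝓘(ℝ, H) 𝓘(ℝ, E) f s p)

/-- Smoothness of a form, tested only at the centre of each preferred chart: the value of `Form.d`
at `x` depends on the representative in the chart at `x` near that point alone. -/
def Form.Smooth (α : Form E Q V n) : Prop :=
  ∀ x : Q, ContDiffAt ℝ ∞ (α.inChart x) (extChartAt 𝓘(ℝ, E) x x)

theorem oneForm_inChart (α : ∀ q : Q, TangentSpace 𝓘(ℝ, E) q →L[ℝ] V) (x : Q) (y : E) :
    (oneForm α).inChart x y = ContinuousAlternatingMap.ofSubsingleton ℝ E V (0 : Fin 1)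
      ((α ((extChartAt 𝓘(ℝ, E) x).symm y)).comp
        (mfderiv 𝓘(ℝ, E) 𝓘(ℝ, E) (extChartAt 𝓘(ℝ, E) x).symm y)) := by
  ext v
  rfl

theorem extDeriv_compContinuousAlternatingMap {W : Type*} [NormedAddCommGroup W] [NormedSpace ℝ W]
    (μ : V →L[ℝ] W) {η : H → H [⋀^Fin n]→L[ℝ] V} {x : H} (hη : DifferentiableAt ℝ η x)
    (v : Fin (n + 1) → H) :
    extDeriv (fun y ↦ μ.compContinuousAlternatingMap (η y)) x v = μ (extDeriv η x v) := by
  have hη' : DifferentiableAt ℝ (fun y ↦ μ.compContinuousAlternatingMap (η y)) x :=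
    (ContinuousLinearMap.compContinuousAlternatingMapCLM ℝ H V W (Fin n)
      μ).differentiableAt.comp x hη
  rw [extDeriv_apply hη', extDeriv_apply hη, map_sum]
  refine Finset.sum_congr rfl fun i _ ↦ ?_
  have hd : DifferentiableAt ℝ (fun y ↦ η y (i.removeNth v)) x := by fun_prop
  have : fderiv ℝ (fun y ↦ μ.compContinuousAlternatingMap (η y) (i.removeNth v)) x =
      μ.comp (fderiv ℝ (fun y ↦ η y (i.removeNth v)) x) :=
    (μ.hasFDerivAt.comp x hd.hasFDerivAt).fderiv
  rw [this, ContinuousLinearMap.comp_apply, map_zsmul]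

/-- The exterior derivative of a one-form commutes with constant linear maps of the values. -/
theorem oneForm_d_comp {W : Type*} [NormedAddCommGroup W] [NormedSpace ℝ W] (μ : V →L[ℝ] W)
    {α : ∀ q : Q, TangentSpace 𝓘(ℝ, E) q →L[ℝ] V} (hα : (oneForm α).Smooth) (q : Q)
    (v : Fin 2 → TangentSpace 𝓘(ℝ, E) q) :
    (oneForm fun q ↦ μ.comp (α q)).d q v = μ ((oneForm α).d q v) := by
  have h : (oneForm fun q ↦ μ.comp (α q)).inChart q =
      fun y ↦ μ.compContinuousAlternatingMap ((oneForm α).inChart q y) := rfl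
  rw [Form.d, Form.d, h]
  exact extDeriv_compContinuousAlternatingMap μ ((hα q).differentiableAt (by simp)) _

variable [IsManifold 𝓘(ℝ, E) ∞ Q]

/-- Near `p`, the pull-back of a form is the pull-back of its representative in the chart at
`f p`. -/
theorem Form.pullbackWithin_eventuallyEq (α : Form E Q V n) {f : H → Q} {s : Set H} {p : H}
    (hf : ContMDiffOn 𝓘(ℝ, H) 𝓘(ℝ, E) ∞ f s) (hs : UniqueDiffOn ℝ s) (hp : p ∈ s) :
    α.pullbackWithin f s =ᶠ[nhdsWithin p s] fun y ↦
      (α.inChart (f p) (extChartAt 𝓘(ℝ, E) (f p) (f y))).compContinuousLinearMap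
        (fderivWithin ℝ (fun y ↦ extChartAt 𝓘(ℝ, E) (f p) (f y)) s y) := by
  have hsrc : ∀ᶠ y in nhdsWithin p s, f y ∈ (extChartAt 𝓘(ℝ, E) (f p)).source :=
    (hf p hp).continuousWithinAt (extChartAt_source_mem_nhds (I := 𝓘(ℝ, E)) (f p))
  filter_upwards [hsrc, self_mem_nhdsWithin] with y hy hys
  have hfy : MDifferentiableWithinAt 𝓘(ℝ, H) 𝓘(ℝ, E) f s y :=
    (hf y hys).mdifferentiableWithinAt (by simp)
  have hy' : f y ∈ (chartAt E (f p)).source := by simpa using hy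
  have hu : UniqueMDiffWithinAt 𝓘(ℝ, H) s y := (hs y hys).uniqueMDiffWithinAt
  have h1 : fderivWithin ℝ (fun y ↦ extChartAt 𝓘(ℝ, E) (f p) (f y)) s y =
      (mfderiv 𝓘(ℝ, E) 𝓘(ℝ, E) (extChartAt 𝓘(ℝ, E) (f p)) (f y)).comp
        (mfderivWithin 𝓘(ℝ, H) 𝓘(ℝ, E) f s y) := by
    rw [← mfderivWithin_eq_fderivWithin]
    exact mfderiv_comp_mfderivWithin (I' := 𝓘(ℝ, E)) y (mdifferentiableAt_extChartAt hy') hfy hu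
  have h2 := mfderivWithin_extChartAt_symm_comp_mfderiv_extChartAt' (I := 𝓘(ℝ, E)) hy
  simp only [ModelWithCorners.range_eq_univ, mfderivWithin_univ] at h2
  rw [h1, Form.inChart, Form.pullbackWithin]
  refine ContinuousAlternatingMap.ext fun v ↦ ?_
  -- the base point `φ⁻¹ (φ (f y))` of the representative is only propositionally equal to `f y`
  have key : ∀ (x : Q) (hx : x = f y) (w : Fin n → TangentSpace 𝓘(ℝ, E) (f y)),
      α x w = α (f y) w := by rintro x rfl w; rfl
  refine Eq.trans ?_ (key _ ((extChartAt 𝓘(ℝ, E) (f p)).left_inv hy) _).symm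
  refine congrArg (α (f y)) (funext fun i ↦ ?_)
  exact (congrArg (fun T ↦ T (mfderivWithin 𝓘(ℝ, H) 𝓘(ℝ, E) f s y (v i))) h2).symm

/-- The exterior derivative commutes with pull-backs, also at boundary points of `s`. -/
theorem Form.extDerivWithin_pullbackWithin {α : Form E Q V n} (hα : α.Smooth)
    {f : H → Q} {s : Set H} {p : H}
    (hf : ContMDiffOn 𝓘(ℝ, H) 𝓘(ℝ, E) ∞ f s) (hs : UniqueDiffOn ℝ s) (hp : p ∈ s)
    (hpc : p ∈ closure (interior s)) :
    extDerivWithin (α.pullbackWithin f s) s p = α.d.pullbackWithin f s p := by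
  rw [(α.pullbackWithin_eventuallyEq hf hs hp).extDerivWithin_eq_of_mem hp]
  have hu : ContDiffWithinAt ℝ ∞ (fun y ↦ extChartAt 𝓘(ℝ, E) (f p) (f y)) s p := by
    rw [← contMDiffWithinAt_iff_contDiffWithinAt]
    exact (contMDiffAt_extChartAt (I := 𝓘(ℝ, E)) (x := f p)).comp_contMDiffWithinAt p (hf p hp)
  rw [extDerivWithin_pullback (t := univ) (r := ∞) (f := fun y ↦ extChartAt 𝓘(ℝ, E) (f p) (f y))
    ((hα (f p)).differentiableAt (by simp)).differentiableWithinAt hu minSmoothness_two_le_infty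
    hs hpc hp (mapsTo_univ _ _), extDerivWithin_univ, Form.pullbackWithin, Form.d]
  have h1 : fderivWithin ℝ (fun y ↦ extChartAt 𝓘(ℝ, E) (f p) (f y)) s p =
      (mfderiv 𝓘(ℝ, E) 𝓘(ℝ, E) (extChartAt 𝓘(ℝ, E) (f p)) (f p)).comp
        (mfderivWithin 𝓘(ℝ, H) 𝓘(ℝ, E) f s p) := by
    rw [← mfderivWithin_eq_fderivWithin]
    exact mfderiv_comp_mfderivWithin (I' := 𝓘(ℝ, E)) p
      (mdifferentiableAt_extChartAt (mem_chart_source E (f p)))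
      ((hf p hp).mdifferentiableWithinAt (by simp)) (hs p hp).uniqueMDiffWithinAt
  rw [h1]
  rfl

/-- The exterior derivative may be computed in any chart: `Form.d` uses a different chart at each
point, yet its representative in one fixed chart is the exterior derivative of the representative of
the form. -/
theorem Form.inChart_d_eqOn {α : Form E Q V n} (hα : α.Smooth) (x : Q) :
    EqOn (α.d.inChart x) (extDeriv (α.inChart x)) (extChartAt 𝓘(ℝ, E) x).target := by
  intro y hy
  have ho : IsOpen (extChartAt 𝓘(ℝ, E) x).target := isOpen_extChartAt_target x
  have hmf : ∀ z ∈ (extChartAt 𝓘(ℝ, E) x).target,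
      mfderivWithin 𝓘(ℝ, E) 𝓘(ℝ, E) (extChartAt 𝓘(ℝ, E) x).symm (extChartAt 𝓘(ℝ, E) x).target z =
        mfderiv 𝓘(ℝ, E) 𝓘(ℝ, E) (extChartAt 𝓘(ℝ, E) x).symm z := fun z hz ↦
    mfderivWithin_of_isOpen ho hz
  have h := Form.extDerivWithin_pullbackWithin hα (contMDiffOn_extChartAt_symm (I := 𝓘(ℝ, E)) x)
    ho.uniqueDiffOn hy (by rw [ho.interior_eq]; exact subset_closure hy)
  rw [Form.pullbackWithin, hmf y hy] at h
  refine h.symm.trans ?_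
  have h' : extDerivWithin (α.pullbackWithin (extChartAt 𝓘(ℝ, E) x).symm
      (extChartAt 𝓘(ℝ, E) x).target) (extChartAt 𝓘(ℝ, E) x).target y =
      extDerivWithin (α.inChart x) (extChartAt 𝓘(ℝ, E) x).target y := by
    refine extDerivWithin_congr' (fun z hz ↦ ?_) hy
    rw [Form.pullbackWithin, hmf z hz]
    rfl
  rw [h', extDerivWithin, extDeriv, fderivWithin_of_isOpen ho hy]

theorem Form.d_d {α : Form E Q V n} (hα : α.Smooth) (x : Q) : α.d.d x = 0 := by
  have h : α.d.inChart x =ᶠ[nhds (extChartAt 𝓘(ℝ, E) x x)] extDeriv (α.inChart x) :=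
    Filter.eventuallyEq_of_mem
      ((isOpen_extChartAt_target x).mem_nhds (mem_extChartAt_target x)) (inChart_d_eqOn hα x)
  rw [Form.d, h.extDeriv_eq, extDeriv_extDeriv_apply (hα x) minSmoothness_two_le_infty]
  rfl

/-- A smooth section of `Hom(TQ, V)` is a smooth one-form: the local representative is the
expression of the section in the trivialisation of `TQ` at `x`. -/
theorem Form.Smooth.oneForm {α : ∀ q : Q, TangentSpace 𝓘(ℝ, E) q →L[ℝ] V}
    (hα : ContMDiff 𝓘(ℝ, E) (𝓘(ℝ, E).prod 𝓘(ℝ, E →L[ℝ] V)) ∞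
      (fun q : Q ↦ Bundle.TotalSpace.mk' (E →L[ℝ] V)
        (E := fun q : Q ↦ TangentSpace 𝓘(ℝ, E) q →L[ℝ] V) q (α q))) :
    (oneForm α).Smooth := by
  intro x
  have h1 := ((contMDiffAt_hom_bundle _).1 (hα x)).2
  have h2 := (contMDiffWithinAt_univ.2 h1).comp_of_eq (I := 𝓘(ℝ, E)) (x := extChartAt 𝓘(ℝ, E) x x)
    (f := (extChartAt 𝓘(ℝ, E) x).symm) (s := (extChartAt 𝓘(ℝ, E) x).target)
    (contMDiffOn_extChartAt_symm x _ (mem_extChartAt_target x)) (mapsTo_univ _ _)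
    (extChartAt_to_inv x)
  have h3 := (h2.contMDiffAt (extChartAt_target_mem_nhds x)).contDiffAt
  have h4 := (ContinuousAlternatingMap.ofSubsingletonLIE (𝕜 := ℝ) (E := E) (F := V)
    (0 : Fin 1)).contDiff.contDiffAt.comp _ h3
  refine h4.congr_of_eventuallyEq ?_
  filter_upwards [extChartAt_target_mem_nhds x] with y hy
  rw [oneForm_inChart]
  refine congrArg (ContinuousAlternatingMap.ofSubsingleton ℝ E V (0 : Fin 1)) ?_
  have hy' : (extChartAt 𝓘(ℝ, E) x).symm y ∈ (chartAt E x).source := by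
    simpa using (extChartAt 𝓘(ℝ, E) x).map_target hy
  have h5 := TangentBundle.symmL_trivializationAt (I := 𝓘(ℝ, E)) hy'
  simp only [ModelWithCorners.range_eq_univ, mfderivWithin_univ] at h5
  rw [(extChartAt 𝓘(ℝ, E) x).right_inv hy] at h5
  simp only [Function.comp_apply, ContinuousLinearMap.inCoordinates]
  rw [← h5]
  exact ContinuousLinearMap.ext fun v ↦ (congrArg (fun T : V →L[ℝ] V ↦ T _)
    (Bundle.Trivial.continuousLinearMapAt_trivialization ℝ Q V _)).symm

end Forms

/-! ### Calculus on a strip -/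

section Strip

/-- The strip `(-δ, δ) × [a, b]` on which deformations of a curve are defined. -/
def strip (δ a b : ℝ) : Set (ℝ × ℝ) := Ioo (-δ) δ ×ˢ Icc a b

variable {δ a b : ℝ}

theorem uniqueDiffOn_strip (hab : a < b) : UniqueDiffOn ℝ (strip δ a b) :=
  (uniqueDiffOn_Ioo _ _).prod (uniqueDiffOn_Icc hab)

theorem strip_subset_closure_interior (hab : a < b) :
    strip δ a b ⊆ closure (interior (strip δ a b)) := by
  rw [strip, interior_prod_eq, closure_prod_eq, isOpen_Ioo.interior_eq, interior_Icc,
    closure_Ioo hab.ne]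
  exact prod_mono subset_closure Subset.rfl

theorem mk_zero_mem_strip (hδ : 0 < δ) {t : ℝ} (ht : t ∈ Icc a b) : ((0 : ℝ), t) ∈ strip δ a b :=
  ⟨⟨neg_lt_zero.2 hδ, hδ⟩, ht⟩

theorem continuousOn_mk_strip {ε : ℝ} (hε : ε ∈ Ioo (-δ) δ) {h : ℝ × ℝ → ℝ}
    (hh : ContinuousOn h (strip δ a b)) : ContinuousOn (fun t ↦ h (ε, t)) (Icc a b) :=
  hh.comp (by fun_prop) fun _ ht ↦ ⟨hε, ht⟩

theorem hasDerivAt_fst_of_strip {h : ℝ × ℝ → ℝ} {ε t : ℝ} (hh : ContDiffOn ℝ ∞ h (strip δ a b))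
    (hε : ε ∈ Ioo (-δ) δ) (ht : t ∈ Icc a b) :
    HasDerivAt (fun x ↦ h (x, t)) (fderivWithin ℝ h (strip δ a b) (ε, t) (1, 0)) ε := by
  have h1 := ((hh.differentiableOn (by simp)) (ε, t) ⟨hε, ht⟩).hasFDerivWithinAt
  have h2 : HasDerivWithinAt (fun x : ℝ ↦ (x, t)) ((1 : ℝ), (0 : ℝ)) (Ioo (-δ) δ) ε :=
    ((hasDerivAt_id ε).prodMk (hasDerivAt_const ε t)).hasDerivWithinAt
  exact (h1.comp_hasDerivWithinAt ε h2 (show MapsTo _ (Ioo (-δ) δ) (strip δ a b) from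
    fun x hx ↦ ⟨hx, ht⟩)).hasDerivAt (Ioo_mem_nhds hε.1 hε.2)

theorem hasDerivWithinAt_snd_of_strip {h : ℝ × ℝ → ℝ} {ε t : ℝ}
    (hh : ContDiffOn ℝ ∞ h (strip δ a b)) (hε : ε ∈ Ioo (-δ) δ) (ht : t ∈ Icc a b) :
    HasDerivWithinAt (fun x ↦ h (ε, x)) (fderivWithin ℝ h (strip δ a b) (ε, t) (0, 1))
      (Icc a b) t := by
  have h1 := ((hh.differentiableOn (by simp)) (ε, t) ⟨hε, ht⟩).hasFDerivWithinAt
  have h2 : HasDerivWithinAt (fun x : ℝ ↦ (ε, x)) ((0 : ℝ), (1 : ℝ)) (Icc a b) t :=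
    ((hasDerivAt_const t ε).prodMk (hasDerivAt_id t)).hasDerivWithinAt
  exact h1.comp_hasDerivWithinAt t h2 fun x hx ↦ ⟨hε, hx⟩

theorem contDiffOn_fderivWithin_strip (hab : a < b) {h : ℝ × ℝ → ℝ}
    (hh : ContDiffOn ℝ ∞ h (strip δ a b)) (w : ℝ × ℝ) :
    ContDiffOn ℝ ∞ (fun p ↦ fderivWithin ℝ h (strip δ a b) p w) (strip δ a b) :=
  (hh.fderivWithin (uniqueDiffOn_strip hab) (by simp)).clm_apply contDiffOn_const

/-- Differentiation under the integral sign of a function that is smooth on a strip. -/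
theorem hasDerivAt_integral_strip (hab : a < b) (hδ : 0 < δ) {h : ℝ × ℝ → ℝ}
    (hh : ContDiffOn ℝ ∞ h (strip δ a b)) :
    HasDerivAt (fun ε ↦ ∫ t in a..b, h (ε, t))
      (∫ t in a..b, fderivWithin ℝ h (strip δ a b) (0, t) (1, 0)) 0 := by
  have hcont := (contDiffOn_fderivWithin_strip hab hh (1, 0)).continuousOn
  have hδ2 : Icc (-(δ / 2)) (δ / 2) ⊆ Ioo (-δ) δ := fun x hx ↦
    ⟨by linarith [hx.1], by linarith [hx.2]⟩
  obtain ⟨C, hC⟩ := (isCompact_Icc.prod isCompact_Icc).exists_bound_of_continuousOn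
    (hcont.mono (prod_mono hδ2 (Subset.refl (Icc a b))))
  have hsub : uIoc a b ⊆ Icc a b := by rw [uIoc_of_le hab.le]; exact Ioc_subset_Icc_self
  have h0 : (0 : ℝ) ∈ Ioo (-δ) δ := ⟨neg_lt_zero.2 hδ, hδ⟩
  have hmeas : ∀ {g : ℝ → ℝ}, ContinuousOn g (Icc a b) →
      AEStronglyMeasurable g (volume.restrict (uIoc a b)) := fun hg ↦
    (hg.mono hsub).aestronglyMeasurable measurableSet_uIoc
  refine (intervalIntegral.hasDerivAt_integral_of_dominated_loc_of_deriv_le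
    (F := fun ε t ↦ h (ε, t))
    (F' := fun ε t ↦ fderivWithin ℝ h (strip δ a b) (ε, t) (1, 0)) (bound := fun _ ↦ C)
    (Icc_mem_nhds (show -(δ / 2) < 0 by linarith) (show 0 < δ / 2 by linarith)) ?_ ?_ ?_ ?_ ?_ ?_).2
  · filter_upwards [Ioo_mem_nhds h0.1 h0.2] with ε hε
    exact hmeas (continuousOn_mk_strip hε hh.continuousOn)
  · exact (continuousOn_mk_strip h0 hh.continuousOn).intervalIntegrable_of_Icc hab.le
  · exact hmeas (continuousOn_mk_strip h0 hcont)
  · exact Filter.Eventually.of_forall fun t ht ε hε ↦ hC (ε, t) ⟨hε, hsub ht⟩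
  · exact intervalIntegrable_const
  · exact Filter.Eventually.of_forall fun t ht ε hε ↦
      hasDerivAt_fst_of_strip hh (hδ2 hε) (hsub ht)

end Strip

/-! ### First variation of the line integral of a one-form -/

section Variation

variable {E : Type*} [NormedAddCommGroup E] [NormedSpace ℝ E]
  {Q : Type*} [TopologicalSpace Q] [ChartedSpace E Q]
  {δ a b : ℝ} {c : ℝ → ℝ → Q}

/-- The derivative of a deformation in the direction `w` of the parameter plane, as a map from the
strip to `TQ`. -/
def stripLift (δ a b : ℝ) (c : ℝ → ℝ → Q) (w : ℝ × ℝ) (p : ℝ × ℝ) : TangentBundle 𝓘(ℝ, E) Q :=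
  ⟨c p.1 p.2, mfderivWithin 𝓘(ℝ, ℝ × ℝ) 𝓘(ℝ, E) (fun p : ℝ × ℝ ↦ c p.1 p.2) (strip δ a b) p w⟩

/-- Velocities of the curves of a deformation are derivatives on the strip, whose joint smoothness
in `(ε, t)` is known. -/
theorem velocity_eq_stripLift (hab : a < b)
    (hc : ContMDiffOn 𝓘(ℝ, ℝ × ℝ) 𝓘(ℝ, E) ∞ (fun p : ℝ × ℝ ↦ c p.1 p.2) (strip δ a b))
    {ε t : ℝ} (hε : ε ∈ Ioo (-δ) δ) (ht : t ∈ Icc a b) :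
    velocity a b (c ε) t = stripLift (E := E) δ a b c (0, 1) (ε, t) := by
  have h1 : HasMFDerivWithinAt 𝓘(ℝ, ℝ × ℝ) 𝓘(ℝ, E) (fun p : ℝ × ℝ ↦ c p.1 p.2) (strip δ a b)
      (ε, t) _ := ((hc (ε, t) ⟨hε, ht⟩).mdifferentiableWithinAt (by simp)).hasMFDerivWithinAt
  have h2 : HasMFDerivWithinAt 𝓘(ℝ, ℝ) 𝓘(ℝ, ℝ × ℝ) (fun x : ℝ ↦ (ε, x)) (Icc a b) t
      (ContinuousLinearMap.inr ℝ ℝ ℝ) :=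
    (hasFDerivAt_prodMk_right ε t).hasMFDerivAt.hasMFDerivWithinAt
  have h3 := (h1.comp t h2 fun x hx ↦ ⟨hε, hx⟩).mfderivWithin
    ((uniqueDiffOn_Icc hab) t ht).uniqueMDiffWithinAt
  exact congrArg (fun T : ℝ →L[ℝ] E ↦ (⟨c ε t, T 1⟩ : TangentBundle 𝓘(ℝ, E) Q)) h3

theorem infVariation_eq_stripLift (hδ : 0 < δ)
    (hc : ContMDiffOn 𝓘(ℝ, ℝ × ℝ) 𝓘(ℝ, E) ∞ (fun p : ℝ × ℝ ↦ c p.1 p.2) (strip δ a b))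
    {t : ℝ} (ht : t ∈ Icc a b) :
    infVariation c t = (stripLift (E := E) δ a b c (1, 0) (0, t)).2 := by
  have h0 : (0 : ℝ) ∈ Ioo (-δ) δ := ⟨neg_lt_zero.2 hδ, hδ⟩
  have h1 : HasMFDerivWithinAt 𝓘(ℝ, ℝ × ℝ) 𝓘(ℝ, E) (fun p : ℝ × ℝ ↦ c p.1 p.2) (strip δ a b)
      (0, t) _ := ((hc (0, t) ⟨h0, ht⟩).mdifferentiableWithinAt (by simp)).hasMFDerivWithinAt
  have h2 : HasMFDerivWithinAt 𝓘(ℝ, ℝ) 𝓘(ℝ, ℝ × ℝ) (fun x : ℝ ↦ (x, t)) (Ioo (-δ) δ) 0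
      (ContinuousLinearMap.inl ℝ ℝ ℝ) :=
    (hasFDerivAt_prodMk_left (0 : ℝ) t).hasMFDerivAt.hasMFDerivWithinAt
  have h3 := ((h1.comp 0 h2 (show Ioo (-δ) δ ⊆ _ ⁻¹' (strip δ a b) from
    fun x hx ↦ ⟨hx, ht⟩)).hasMFDerivAt (Ioo_mem_nhds h0.1 h0.2)).mfderiv
  exact congrArg (fun T : ℝ →L[ℝ] E ↦ T 1) h3

variable [IsManifold 𝓘(ℝ, E) ∞ Q]

theorem contMDiffOn_stripLift (hab : a < b)
    (hc : ContMDiffOn 𝓘(ℝ, ℝ × ℝ) 𝓘(ℝ, E) ∞ (fun p : ℝ × ℝ ↦ c p.1 p.2) (strip δ a b))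
    (w : ℝ × ℝ) :
    ContMDiffOn 𝓘(ℝ, ℝ × ℝ) 𝓘(ℝ, E).tangent ∞ (stripLift (E := E) δ a b c w) (strip δ a b) := by
  have : IsManifold 𝓘(ℝ, E) 1 Q := IsManifold.of_le (n := ∞) (by simp)
  have h1 := hc.contMDiffOn_tangentMapWithin (m := ∞) (by simp)
    (uniqueDiffOn_strip hab).uniqueMDiffOn
  have h2 : ContMDiff 𝓘(ℝ, ℝ × ℝ) 𝓘(ℝ, ℝ × ℝ).tangent ∞
      (fun p : ℝ × ℝ ↦ (⟨p, w⟩ : TangentBundle 𝓘(ℝ, ℝ × ℝ) (ℝ × ℝ))) := by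
    intro p
    refine Bundle.contMDiffAt_totalSpace.2 ⟨contMDiffAt_id, ?_⟩
    simpa using contMDiffAt_const
  exact h1.comp h2.contMDiffOn fun p hp ↦ hp

theorem contDiffOn_comp_stripLift (hab : a < b)
    (hc : ContMDiffOn 𝓘(ℝ, ℝ × ℝ) 𝓘(ℝ, E) ∞ (fun p : ℝ × ℝ ↦ c p.1 p.2) (strip δ a b))
    (w : ℝ × ℝ) {L : TangentBundle 𝓘(ℝ, E) Q → ℝ} (hL : SmoothLagrangian L) :
    ContDiffOn ℝ ∞ (fun p ↦ L (stripLift δ a b c w p)) (strip δ a b) := by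
  rw [← contMDiffOn_iff_contDiffOn]
  exact hL.comp_contMDiffOn (contMDiffOn_stripLift hab hc w)

/-- The values of a smooth force term on smooth vector fields along a map are smooth. -/
theorem SmoothForceTerm.contDiffOn_stripLift {F : ForceTerm E Q} (hF : SmoothForceTerm F)
    (hab : a < b)
    (hc : ContMDiffOn 𝓘(ℝ, ℝ × ℝ) 𝓘(ℝ, E) ∞ (fun p : ℝ × ℝ ↦ c p.1 p.2) (strip δ a b))
    (w w' : ℝ × ℝ) :
    ContDiffOn ℝ ∞ (fun p ↦ F (stripLift δ a b c w p) (stripLift (E := E) δ a b c w' p).2)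
      (strip δ a b) := by
  rw [← contMDiffOn_iff_contDiffOn]
  have h1 := hF.comp_contMDiffOn (contMDiffOn_stripLift hab hc w)
  have h2 := ContMDiffOn.clm_bundle_apply (F₁ := E) (F₂ := ℝ)
    (E₁ := (TangentSpace 𝓘(ℝ, E) : Q → Type _)) (E₂ := Bundle.Trivial Q ℝ)
    (b := fun p : ℝ × ℝ ↦ c p.1 p.2) (ϕ := fun p ↦ F (stripLift δ a b c w p))
    (v := fun p ↦ (stripLift (E := E) δ a b c w' p).2) h1 (contMDiffOn_stripLift hab hc w')
  intro p hp
  exact (Bundle.contMDiffWithinAt_totalSpace.1 (h2 p hp)).2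

/-- A smooth one-form is a smooth function on `TQ`. -/
theorem smoothLagrangian_of_smooth_section {α : ∀ q : Q, TangentSpace 𝓘(ℝ, E) q →L[ℝ] ℝ}
    (hα : ContMDiff 𝓘(ℝ, E) (𝓘(ℝ, E).prod 𝓘(ℝ, E →L[ℝ] ℝ)) ∞
      (fun q : Q ↦ Bundle.TotalSpace.mk' (E →L[ℝ] ℝ)
        (E := fun q : Q ↦ TangentSpace 𝓘(ℝ, E) q →L[ℝ] ℝ) q (α q))) :
    SmoothLagrangian (fun v : TangentBundle 𝓘(ℝ, E) Q ↦ α v.proj v.2) := by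
  have : IsManifold 𝓘(ℝ, E) 1 Q := IsManifold.of_le (n := ∞) (by simp)
  have h1 := hα.comp (Bundle.contMDiff_proj (IB := 𝓘(ℝ, E)) (F := E)
    (TangentSpace 𝓘(ℝ, E) : Q → Type _) (n := ∞))
  have h2 := ContMDiff.clm_bundle_apply (F₁ := E) (F₂ := ℝ)
    (E₁ := (TangentSpace 𝓘(ℝ, E) : Q → Type _)) (E₂ := Bundle.Trivial Q ℝ)
    (b := fun v : TangentBundle 𝓘(ℝ, E) Q ↦ v.proj) (ϕ := fun v ↦ α v.proj)
    (v := fun v ↦ v.2) h1 contMDiff_id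
  intro p
  exact (Bundle.contMDiffAt_totalSpace.1 (h2 p)).2

/-- First variation of the line integral of a one-form `α` along a curve with fixed endpoints: it
is the integral of `dα(δq, q̇)`. -/
theorem hasDerivAt_integral_oneForm (hab : a < b)
    {α : ∀ q : Q, TangentSpace 𝓘(ℝ, E) q →L[ℝ] ℝ}
    (hα : ContMDiff 𝓘(ℝ, E) (𝓘(ℝ, E).prod 𝓘(ℝ, E →L[ℝ] ℝ)) ∞
      (fun q : Q ↦ Bundle.TotalSpace.mk' (E →L[ℝ] ℝ)
        (E := fun q : Q ↦ TangentSpace 𝓘(ℝ, E) q →L[ℝ] ℝ) q (α q)))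
    {q : ℝ → Q} (hc : IsVariation E a b q c) :
    IntervalIntegrable (fun t ↦ (oneForm α).d (c 0 t) ![infVariation c t, (velocity a b (c 0) t).2])
        volume a b ∧
      HasDerivAt (fun ε ↦ ∫ t in a..b, α (c ε t) (velocity a b (c ε) t).2)
        (∫ t in a..b, (oneForm α).d (c 0 t) ![infVariation c t, (velocity a b (c 0) t).2]) 0 := by
  obtain ⟨-, δ, hδ, hcs, hends⟩ := hc
  change ContMDiffOn 𝓘(ℝ, ℝ × ℝ) 𝓘(ℝ, E) ∞ (fun p : ℝ × ℝ ↦ c p.1 p.2) (strip δ a b) at hcs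
  have hΛ := smoothLagrangian_of_smooth_section hα
  have h0 : (0 : ℝ) ∈ Ioo (-δ) δ := ⟨neg_lt_zero.2 hδ, hδ⟩
  let h (w : ℝ × ℝ) (p : ℝ × ℝ) : ℝ := α (c p.1 p.2) (stripLift (E := E) δ a b c w p).2
  have hh : ∀ w, ContDiffOn ℝ ∞ (h w) (strip δ a b) := fun w ↦
    contDiffOn_comp_stripLift hab hcs w hΛ
  -- `dα(δq, q̇) = ∂_ε (α(q̇)) - ∂_t (α(δq))`
  have key : ∀ t ∈ Icc a b, (oneForm α).d (c 0 t) ![infVariation c t, (velocity a b (c 0) t).2] =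
      fderivWithin ℝ (h (0, 1)) (strip δ a b) (0, t) (1, 0) -
        fderivWithin ℝ (h (1, 0)) (strip δ a b) (0, t) (0, 1) := by
    intro t ht
    have hp := mk_zero_mem_strip hδ ht
    have e1 := Form.extDerivWithin_pullbackWithin (Form.Smooth.oneForm hα) hcs
      (uniqueDiffOn_strip hab) hp (strip_subset_closure_interior hab hp)
    -- the pull-back of `α` is `α(∂_ε c) dε + α(∂_t c) dt`
    have e2 : (oneForm α).pullbackWithin (fun p : ℝ × ℝ ↦ c p.1 p.2) (strip δ a b) = fun p ↦
        ContinuousAlternatingMap.ofSubsingletonLIE (𝕜 := ℝ) (E := ℝ × ℝ) (F := ℝ) (0 : Fin 1)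
          (h (1, 0) p • ContinuousLinearMap.fst ℝ ℝ ℝ +
            h (0, 1) p • ContinuousLinearMap.snd ℝ ℝ ℝ) := by
      funext p
      refine ContinuousAlternatingMap.ext fun v ↦ ?_
      have hT : ∀ (T : ℝ × ℝ →L[ℝ] ℝ) (x : ℝ × ℝ), T x = T (1, 0) * x.1 + T (0, 1) * x.2 := by
        intro T x
        conv_lhs => rw [show x = x.1 • ((1 : ℝ), (0 : ℝ)) + x.2 • ((0 : ℝ), (1 : ℝ)) by simp]
        rw [map_add, map_smul, map_smul, smul_eq_mul, smul_eq_mul]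
        ring
      exact hT ((α (c p.1 p.2)).comp (mfderivWithin 𝓘(ℝ, ℝ × ℝ) 𝓘(ℝ, E)
        (fun p : ℝ × ℝ ↦ c p.1 p.2) (strip δ a b) p)) (v 0)
    have e3 : DifferentiableWithinAt ℝ ((oneForm α).pullbackWithin (fun p : ℝ × ℝ ↦ c p.1 p.2)
        (strip δ a b)) (strip δ a b) (0, t) := by
      rw [e2]
      have hd : ∀ w, DifferentiableWithinAt ℝ (h w) (strip δ a b) (0, t) := fun w ↦
        (hh w).differentiableOn (by simp) _ hp
      exact (LinearIsometryEquiv.differentiable _).differentiableAt.comp_differentiableWithinAt _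
        (((hd _).smul_const _).add ((hd _).smul_const _))
    have e4 := extDerivWithin_apply e3 (uniqueDiffOn_strip hab _ hp) ![(1, 0), (0, 1)]
    rw [e1, Fin.sum_univ_two] at e4
    have e5 : (oneForm α).d (c 0 t) ![infVariation c t, (velocity a b (c 0) t).2] =
        (oneForm α).d.pullbackWithin (fun p : ℝ × ℝ ↦ c p.1 p.2) (strip δ a b) (0, t)
          ![(1, 0), (0, 1)] := by
      rw [infVariation_eq_stripLift hδ hcs ht, velocity_eq_stripLift hab hcs h0 ht]
      refine congrArg ((oneForm α).d (c 0 t)) (funext fun i ↦ ?_)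
      fin_cases i <;> rfl
    rw [e5, e4]
    simp only [Fin.val_zero, pow_zero, one_smul, Fin.val_one, pow_one, neg_smul, ← sub_eq_add_neg]
    rfl
  have hint : ∀ w w', IntervalIntegrable
      (fun t ↦ fderivWithin ℝ (h w) (strip δ a b) (0, t) w') volume a b := fun w w' ↦
    (continuousOn_mk_strip h0
      (contDiffOn_fderivWithin_strip hab (hh w) w').continuousOn).intervalIntegrable_of_Icc hab.le
  have hkey : EqOn (fun t ↦ (oneForm α).d (c 0 t) ![infVariation c t, (velocity a b (c 0) t).2])
      (fun t ↦ fderivWithin ℝ (h (0, 1)) (strip δ a b) (0, t) (1, 0) -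
        fderivWithin ℝ (h (1, 0)) (strip δ a b) (0, t) (0, 1)) (uIcc a b) := by
    rw [uIcc_of_le hab.le]
    exact key
  refine ⟨((hint (0, 1) (1, 0)).sub (hint (1, 0) (0, 1))).congr fun t ht ↦
    (hkey (uIoc_subset_uIcc ht)).symm, ?_⟩
  rw [intervalIntegral.integral_congr hkey, intervalIntegral.integral_sub (hint _ _) (hint _ _)]
  -- the boundary terms vanish because the endpoints are fixed
  have hbdry : ∀ t ∈ Icc a b, (∀ ε ∈ Ioo (-δ) δ, c ε t = c 0 t) → h (1, 0) (0, t) = 0 := by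
    intro t ht hconst
    have : infVariation (E := E) c t = 0 := by
      have hev : (fun ε ↦ c ε t) =ᶠ[nhds 0] fun _ ↦ c 0 t := by
        filter_upwards [Ioo_mem_nhds h0.1 h0.2] with ε hε using hconst ε hε
      rw [infVariation, hev.mfderiv_eq, mfderiv_const]
      rfl
    rw [infVariation_eq_stripLift hδ hcs ht] at this
    exact (congrArg (α (c 0 t)) this).trans (map_zero _)
  have hFTC : ∫ t in a..b, fderivWithin ℝ (h (1, 0)) (strip δ a b) (0, t) (0, 1) = 0 := by
    rw [intervalIntegral.integral_eq_sub_of_hasDerivAt_of_le hab.le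
      (continuousOn_mk_strip h0 (hh (1, 0)).continuousOn)
      (fun t ht ↦ (hasDerivWithinAt_snd_of_strip (hh (1, 0)) h0
        (Ioo_subset_Icc_self ht)).hasDerivAt (Icc_mem_nhds ht.1 ht.2)) (hint _ _),
      hbdry b (right_mem_Icc.2 hab.le) fun ε hε ↦ by rw [(hends ε hε).2, (hends 0 h0).2],
      hbdry a (left_mem_Icc.2 hab.le) fun ε hε ↦ by rw [(hends ε hε).1, (hends 0 h0).1], sub_zero]
  rw [hFTC, sub_zero]
  refine (hasDerivAt_integral_strip hab hδ (hh (0, 1))).congr_of_eventuallyEq ?_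
  filter_upwards [Ioo_mem_nhds h0.1 h0.2] with ε hε
  refine intervalIntegral.integral_congr fun t ht ↦ ?_
  rw [uIcc_of_le hab.le] at ht
  simp only [h]
  exact congrArg (fun v : TangentBundle 𝓘(ℝ, E) Q ↦ α v.proj v.2)
    (velocity_eq_stripLift hab hcs hε ht)

end Variation

/-! ### Critical curves and gyroscopic forces -/

section Gyroscopic

variable {E : Type*} [NormedAddCommGroup E] [NormedSpace ℝ E]
  {Q : Type*} [TopologicalSpace Q] [ChartedSpace E Q] [IsManifold 𝓘(ℝ, E) ∞ Q]
  {δ a b : ℝ} {c : ℝ → ℝ → Q} {q : ℝ → Q}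

theorem SmoothLagrangian.eventually_intervalIntegrable {L : TangentBundle 𝓘(ℝ, E) Q → ℝ}
    (hL : SmoothLagrangian L) (hab : a < b) (hc : IsVariation E a b q c) :
    ∀ᶠ ε in nhds (0 : ℝ), IntervalIntegrable (fun t ↦ L (velocity a b (c ε) t)) volume a b := by
  obtain ⟨-, δ, hδ, hcs, -⟩ := hc
  filter_upwards [Ioo_mem_nhds (neg_lt_zero.2 hδ) hδ] with ε hε
  refine ContinuousOn.intervalIntegrable_of_Icc hab.le ?_
  exact (continuousOn_mk_strip hε (contDiffOn_comp_stripLift hab hcs (0, 1) hL).continuousOn).congr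
    fun t ht ↦ congrArg L (velocity_eq_stripLift hab hcs hε ht)

theorem SmoothForceTerm.intervalIntegrable {F : ForceTerm E Q} (hF : SmoothForceTerm F)
    (hab : a < b) (hc : IsVariation E a b q c) :
    IntervalIntegrable (fun t ↦ F (velocity a b (c 0) t) (infVariation c t)) volume a b := by
  obtain ⟨-, δ, hδ, hcs, -⟩ := hc
  have h0 : (0 : ℝ) ∈ Ioo (-δ) δ := ⟨neg_lt_zero.2 hδ, hδ⟩
  refine ContinuousOn.intervalIntegrable_of_Icc hab.le ?_
  refine (continuousOn_mk_strip h0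
    (hF.contDiffOn_stripLift hab hcs (0, 1) (1, 0)).continuousOn).congr fun t ht ↦ ?_
  have h1 := infVariation_eq_stripLift (E := E) hδ hcs ht
  exact (congrArg (F (velocity a b (c 0) t)) h1).trans
    (by rw [velocity_eq_stripLift hab hcs h0 ht])

/-- Subtracting a one-form `α` from a Lagrangian is compensated by the gyroscopic force term of
`dα`: the critical curves do not change. -/
theorem isCriticalCurve_sub_oneForm_iff (hab : a < b) {L : TangentBundle 𝓘(ℝ, E) Q → ℝ}
    (hL : SmoothLagrangian L) {F : ForceTerm E Q} (hF : SmoothForceTerm F)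
    {α : ∀ q : Q, TangentSpace 𝓘(ℝ, E) q →L[ℝ] ℝ}
    (hα : ContMDiff 𝓘(ℝ, E) (𝓘(ℝ, E).prod 𝓘(ℝ, E →L[ℝ] ℝ)) ∞
      (fun q : Q ↦ Bundle.TotalSpace.mk' (E →L[ℝ] ℝ)
        (E := fun q : Q ↦ TangentSpace 𝓘(ℝ, E) q →L[ℝ] ℝ) q (α q))) :
    IsCriticalCurve L F a b q ↔
      IsCriticalCurve (fun v ↦ L v - α v.proj v.2) (F + gyroscopicForce (oneForm α).d) a b q := by
  refine and_congr_right fun _ ↦ forall_congr' fun c ↦ forall_congr' fun hc ↦ ?_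
  obtain ⟨hi, hd⟩ := hasDerivAt_integral_oneForm hab hα hc
  set D : ℝ → ℝ := fun t ↦
    (oneForm α).d (c 0 t) ![infVariation c t, (velocity a b (c 0) t).2] with hD
  -- splitting the integrals needs integrability, hence the equality is only local in `ε`
  have hact : (fun ε ↦ ∫ t in a..b, (L (velocity a b (c ε) t) -
      α (velocity a b (c ε) t).proj (velocity a b (c ε) t).2)) =ᶠ[nhds 0]
      (fun ε ↦ ∫ t in a..b, L (velocity a b (c ε) t)) -
        fun ε ↦ ∫ t in a..b, α (c ε t) (velocity a b (c ε) t).2 := by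
    filter_upwards [hL.eventually_intervalIntegrable hab hc,
      (smoothLagrangian_of_smooth_section hα).eventually_intervalIntegrable hab hc] with ε h1 h2
    exact intervalIntegral.integral_sub h1 h2
  have hforce : ∫ t in a..b, (F + gyroscopicForce (oneForm α).d) (velocity a b (c 0) t)
      (infVariation c t) = (∫ t in a..b, F (velocity a b (c 0) t) (infVariation c t)) +
        ∫ t in a..b, D t := by
    rw [← intervalIntegral.integral_add (hF.intervalIntegrable hab hc) hi]
    congr 1
    funext t
    have h1 := gyroscopicForce_apply (oneForm α).d (c 0 t) (velocity a b (c 0) t).2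
      (infVariation c t)
    have h2 : (oneForm α).d (c 0 t) ![(velocity a b (c 0) t).2, infVariation c t] = - D t := by
      have h3 := ((oneForm α).d (c 0 t)).map_swap ![infVariation c t, (velocity a b (c 0) t).2]
        (i := 0) (j := 1) (by decide)
      refine Eq.trans (congrArg ((oneForm α).d (c 0 t)) (funext fun i ↦ ?_)) h3
      fin_cases i <;> rfl
    rw [h2, neg_neg] at h1
    exact congrArg (F (velocity a b (c 0) t) (infVariation c t) + ·) h1
  rw [hact.hasDerivAt_iff, hforce, neg_add, ← sub_eq_add_neg]
  refine ⟨fun h ↦ h.sub hd, fun h ↦ ?_⟩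
  simpa using! h.add hd

end Gyroscopic

/-! ### The momentum map -/

section Fibre

variable {E : Type*} [NormedAddCommGroup E] [NormedSpace ℝ E]
  {Q : Type*} [TopologicalSpace Q] [ChartedSpace E Q]
  {𝔼 : Type*} [NormedAddCommGroup 𝔼] [NormedSpace ℝ 𝔼]
  {G : Type*} [TopologicalSpace G] [ChartedSpace 𝔼 G] [Group G] [MulAction Gᵐᵒᵖ Q]

theorem momentumMap_oneForm (α : ∀ q : Q, TangentSpace 𝓘(ℝ, E) q →L[ℝ] ℝ)
    (v : TangentBundle 𝓘(ℝ, E) Q) (ξ : 𝔼) :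
    momentumMap (𝔼 := 𝔼) (G := G) (fun v ↦ α v.proj v.2) v ξ =
      α v.proj (infAction (𝔼 := 𝔼) (G := G) E v.proj ξ) := by
  have h := ((hasDerivAt_id (0 : ℝ)).mul_const
    (α v.proj (infAction (𝔼 := 𝔼) (G := G) E v.proj ξ))).const_add (α v.proj v.2)
  rw [one_mul] at h
  refine Eq.trans ?_ h.deriv
  simp only [momentumMap, map_add, map_smul, smul_eq_mul, id]

variable [IsManifold 𝓘(ℝ, E) ∞ Q]

theorem SmoothLagrangian.differentiable_fibre {L : TangentBundle 𝓘(ℝ, E) Q → ℝ}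
    (hL : SmoothLagrangian L) (q : Q) : Differentiable ℝ (fun v : E ↦ L ⟨q, v⟩) := by
  have h1 : ContMDiff 𝓘(ℝ, E) 𝓘(ℝ, E).tangent ∞
      (fun v : E ↦ (⟨q, v⟩ : TangentBundle 𝓘(ℝ, E) Q)) := by
    intro v
    refine Bundle.contMDiffAt_totalSpace.2 ⟨contMDiffAt_const, ?_⟩
    let T : E →L[ℝ] E :=
      (trivializationAt E (TangentSpace 𝓘(ℝ, E)) q).continuousLinearMapAt ℝ q
    have h2 : ContMDiffAt 𝓘(ℝ, E) 𝓘(ℝ, E) ∞ T v := T.contDiff.contMDiff v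
    refine h2.congr_of_eventuallyEq (Filter.Eventually.of_forall fun w ↦ ?_)
    have h3 := (trivializationAt E (TangentSpace 𝓘(ℝ, E)) q).coe_linearMapAt_of_mem (R := ℝ)
      (FiberBundle.mem_baseSet_trivializationAt' q)
    exact (congrFun h3 w).symm
  exact (contMDiff_iff_contDiff.1 (hL.comp h1)).differentiable (by simp)

/-- The momentum map is the fibre derivative of the Lagrangian evaluated on the infinitesimal
generators. -/
theorem momentumMap_eq_fderiv {L : TangentBundle 𝓘(ℝ, E) Q → ℝ} (hL : SmoothLagrangian L) (x : Q)
    (v : E) (ξ : 𝔼) :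
    momentumMap (𝔼 := 𝔼) (G := G) L ⟨x, v⟩ ξ =
      fderiv ℝ (fun w : E ↦ L ⟨x, w⟩) v (infAction (𝔼 := 𝔼) (G := G) E x ξ) := by
  let u : E := infAction (𝔼 := 𝔼) (G := G) E x ξ
  have h1 : HasDerivAt (fun ε : ℝ ↦ v + ε • u) u 0 := by
    have h := ((hasDerivAt_id (0 : ℝ)).smul_const u).const_add v
    rw [one_smul] at h
    exact h
  have h2 : HasFDerivAt (fun w : E ↦ L ⟨x, w⟩) (fderiv ℝ (fun w : E ↦ L ⟨x, w⟩) v)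
      (v + (0 : ℝ) • u) := by
    rw [zero_smul, add_zero]
    exact (hL.differentiable_fibre x v).hasFDerivAt
  exact (h2.comp_hasDerivAt 0 h1).deriv

theorem momentumMap_sub {L L' : TangentBundle 𝓘(ℝ, E) Q → ℝ} (hL : SmoothLagrangian L)
    (hL' : SmoothLagrangian L') (v : TangentBundle 𝓘(ℝ, E) Q) (ξ : 𝔼) :
    momentumMap (𝔼 := 𝔼) (G := G) (L - L') v ξ =
      momentumMap (𝔼 := 𝔼) (G := G) L v ξ - momentumMap (𝔼 := 𝔼) (G := G) L' v ξ := by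
  have hL0 (M : TangentBundle 𝓘(ℝ, E) Q → ℝ) (hM : SmoothLagrangian M) : DifferentiableAt ℝ
      (fun ε : ℝ ↦ M ⟨v.proj, v.2 + ε • infAction (𝔼 := 𝔼) (G := G) E v.proj ξ⟩) 0 := by
    let u : E := infAction (𝔼 := 𝔼) (G := G) E v.proj ξ
    let w : E := v.2
    have h : DifferentiableAt ℝ (fun ε : ℝ ↦ w + ε • u) 0 := by fun_prop
    exact (hM.differentiable_fibre v.proj _).comp (0 : ℝ) h
  exact deriv_sub (hL0 L hL) (hL0 L' hL')

end Fibre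

/-! ### Curves in a Lie group -/

section LieGroupCurve

variable {𝔼 : Type*} [NormedAddCommGroup 𝔼] [NormedSpace ℝ 𝔼]
  {G : Type*} [TopologicalSpace G] [ChartedSpace 𝔼 G] [Group G]

/-- The right logarithmic derivative `γ̇(s) γ(s)⁻¹` of a curve in a Lie group. It is tangent to `G`
at `γ(s) γ(s)⁻¹ = 1` and is regarded as a vector of the model space `𝔼` of the Lie algebra. -/
def rightLogDeriv (𝔼 : Type*) [NormedAddCommGroup 𝔼] [NormedSpace ℝ 𝔼]
    {G : Type*} [TopologicalSpace G] [ChartedSpace 𝔼 G] [Group G] (γ : ℝ → G) (s : ℝ) : 𝔼 :=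
  mfderiv 𝓘(ℝ, ℝ) 𝓘(ℝ, 𝔼) (fun y ↦ γ y * (γ s)⁻¹) s (1 : ℝ)

theorem rightLogDeriv_zero {γ : ℝ → G} (h1 : γ 0 = 1) :
    rightLogDeriv 𝔼 γ 0 = mfderiv 𝓘(ℝ, ℝ) 𝓘(ℝ, 𝔼) γ 0 (1 : ℝ) := by
  have : (fun y ↦ γ y * (γ 0)⁻¹) = γ := by simp [h1]
  exact congrArg (fun δ : ℝ → G ↦ (mfderiv 𝓘(ℝ, ℝ) 𝓘(ℝ, 𝔼) δ 0 (1 : ℝ) : 𝔼)) this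

variable [LieGroup 𝓘(ℝ, 𝔼) ∞ G]

/-- Every element of the Lie algebra is the initial velocity of a smooth curve through the unit. -/
theorem exists_curve_of_groupLieAlgebra (ξ : 𝔼) :
    ∃ r > 0, ∃ γ : ℝ → G, ContMDiffOn 𝓘(ℝ, ℝ) 𝓘(ℝ, 𝔼) ∞ γ (Ioo (-r) r) ∧ γ 0 = 1 ∧
      rightLogDeriv 𝔼 γ 0 = ξ := by
  have : IsManifold 𝓘(ℝ, 𝔼) ∞ G :=
    (LieGroup.toContMDiffMul (I := 𝓘(ℝ, 𝔼)) (n := ∞) (G := G)).toIsManifold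
  have : IsManifold 𝓘(ℝ, 𝔼) 1 G := IsManifold.of_le (n := ∞) (by simp)
  set φ := extChartAt 𝓘(ℝ, 𝔼) (1 : G) with hφ
  let l : ℝ → 𝔼 := fun s ↦ φ 1 + s • (ξ : 𝔼)
  have hl : ContDiff ℝ ∞ l := by fun_prop
  have hl0 : l 0 = φ 1 := by simp [l]
  have htgt : l ⁻¹' φ.target ∈ nhds (0 : ℝ) := by
    refine hl.continuous.continuousAt.preimage_mem_nhds ?_
    rw [hl0]
    exact extChartAt_target_mem_nhds (I := 𝓘(ℝ, 𝔼)) (1 : G)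
  obtain ⟨r, hr, hball⟩ := Metric.mem_nhds_iff.1 htgt
  rw [Real.ball_eq_Ioo, zero_sub, zero_add] at hball
  refine ⟨r, hr, φ.symm ∘ l, ?_, ?_, ?_⟩
  · exact (contMDiffOn_extChartAt_symm (I := 𝓘(ℝ, 𝔼)) (1 : G)).comp
      hl.contMDiff.contMDiffOn hball
  · simp [hl0, hφ]
  · refine (rightLogDeriv_zero (by simp [hl0, hφ])).trans ?_
    have h1 : mfderiv 𝓘(ℝ, 𝔼) 𝓘(ℝ, 𝔼) φ.symm (l 0) = ContinuousLinearMap.id ℝ 𝔼 := by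
      rw [hl0]
      have := mfderivWithin_range_extChartAt_symm (I := 𝓘(ℝ, 𝔼)) (x := (1 : G))
      simpa only [ModelWithCorners.range_eq_univ, mfderivWithin_univ] using! this
    have h2 : HasDerivAt l ξ 0 := by
      have h := ((hasDerivAt_id (0 : ℝ)).smul_const ξ).const_add (φ 1)
      rw [one_smul] at h
      exact h
    have hd : MDifferentiableAt 𝓘(ℝ, 𝔼) 𝓘(ℝ, 𝔼) φ.symm (φ 1) :=
      ((contMDiffOn_extChartAt_symm (I := 𝓘(ℝ, 𝔼)) (1 : G)).contMDiffAt
        (extChartAt_target_mem_nhds (I := 𝓘(ℝ, 𝔼)) (1 : G))).mdifferentiableAt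
        (n := ∞) (by simp)
    rw [mfderiv_comp_of_eq hd h2.differentiableAt.mdifferentiableAt hl0]
    refine (congrArg (fun T : 𝔼 →L[ℝ] 𝔼 ↦ T (mfderiv 𝓘(ℝ, ℝ) 𝓘(ℝ, 𝔼) l 0 (1 : ℝ))) h1).trans ?_
    rw [mfderiv_eq_fderiv]
    exact h2.deriv

/-- In the chart at the unit, the right logarithmic derivative is a partial derivative of the smooth
map `(s, y) ↦ γ(y) γ(s)⁻¹`. -/
theorem differentiableAt_rightLogDeriv {γ : ℝ → G} {r : ℝ} (hr : 0 < r)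
    (hγ : ContMDiffOn 𝓘(ℝ, ℝ) 𝓘(ℝ, 𝔼) ∞ γ (Ioo (-r) r)) :
    DifferentiableAt ℝ (rightLogDeriv 𝔼 γ) 0 := by
  have : IsManifold 𝓘(ℝ, 𝔼) ∞ G :=
    (LieGroup.toContMDiffMul (I := 𝓘(ℝ, 𝔼)) (n := ∞) (G := G)).toIsManifold
  have : IsManifold 𝓘(ℝ, 𝔼) 1 G := IsManifold.of_le (n := ∞) (by simp)
  have hγs : ∀ s ∈ Ioo (-r) r, ContMDiffAt 𝓘(ℝ, ℝ) 𝓘(ℝ, 𝔼) ∞ γ s := fun s hs ↦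
    hγ.contMDiffAt (Ioo_mem_nhds hs.1 hs.2)
  have h0 : (0 : ℝ) ∈ Ioo (-r) r := ⟨neg_lt_zero.2 hr, hr⟩
  let K : ℝ → ℝ → 𝔼 := fun s y ↦ extChartAt 𝓘(ℝ, 𝔼) (1 : G) (γ y * (γ s)⁻¹)
  have hK : ContDiffAt ℝ ∞ (Function.uncurry K) (0, 0) := by
    rw [← contMDiffAt_iff_contDiffAt]
    have h1 : ContMDiffAt 𝓘(ℝ, ℝ × ℝ) 𝓘(ℝ, 𝔼) ∞ (fun p : ℝ × ℝ ↦ γ p.2 * (γ p.1)⁻¹) (0, 0) :=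
      ((hγs 0 h0).comp_of_eq (x := ((0 : ℝ), (0 : ℝ))) contDiff_snd.contMDiff.contMDiffAt rfl).mul
        ((hγs 0 h0).comp_of_eq (x := ((0 : ℝ), (0 : ℝ)))
          contDiff_fst.contMDiff.contMDiffAt rfl).inv
    exact (contMDiffAt_extChartAt (I := 𝓘(ℝ, 𝔼)) (x := (1 : G))).comp_of_eq h1 (by simp)
  have h2 : ContDiffAt ℝ 1 (fun s ↦ fderiv ℝ (K s) s (1 : ℝ)) 0 :=
    (ContDiffAt.fderiv (m := 1) (n := ∞) hK contDiffAt_id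
      (by rw [one_add_one_eq_two]; exact WithTop.coe_le_coe.2 le_top)).clm_apply contDiffAt_const
  refine (h2.differentiableAt one_ne_zero).congr_of_eventuallyEq ?_
  filter_upwards [Ioo_mem_nhds h0.1 h0.2] with s hs
  have h3 : MDifferentiableAt 𝓘(ℝ, ℝ) 𝓘(ℝ, 𝔼) (fun y ↦ γ y * (γ s)⁻¹) s :=
    ((hγs s hs).mul contMDiffAt_const).mdifferentiableAt (by simp)
  have h4 : γ s * (γ s)⁻¹ = 1 := mul_inv_cancel _
  have h5 := mfderiv_comp_of_eq (I := 𝓘(ℝ, ℝ)) (x := s) (f := fun y ↦ γ y * (γ s)⁻¹)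
    (mdifferentiableAt_extChartAt (I := 𝓘(ℝ, 𝔼)) (mem_chart_source 𝔼 (1 : G))) h3 h4
  have h6 : ∀ g : G, g = 1 → ∀ w : 𝔼,
      (mfderiv 𝓘(ℝ, 𝔼) 𝓘(ℝ, 𝔼) (extChartAt 𝓘(ℝ, 𝔼) (1 : G)) g w : 𝔼) = w := by
    rintro _ rfl w
    rw [mfderiv_extChartAt_self]
    rfl
  rw [mfderiv_eq_fderiv] at h5
  exact ((congrArg (fun T : ℝ →L[ℝ] 𝔼 ↦ T 1) h5).trans (h6 _ h4 _)).symm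

end LieGroupCurve

/-! ### Velocities and the group action -/

section Noether

variable {E : Type*} [NormedAddCommGroup E] [NormedSpace ℝ E]
  {Q : Type*} [TopologicalSpace Q] [ChartedSpace E Q]
  {𝔼 : Type*} [NormedAddCommGroup 𝔼] [NormedSpace ℝ 𝔼]
  {G : Type*} [TopologicalSpace G] [ChartedSpace 𝔼 G] [Group G] [MulAction Gᵐᵒᵖ Q]
  {a b : ℝ} {q : ℝ → Q} {γ : ℝ → G}

theorem tangentBundle_mk_congr {x x' : Q} (hx : x = x') {v v' : E} (hv : v = v') :
    (⟨x, v⟩ : TangentBundle 𝓘(ℝ, E) Q) = ⟨x', v'⟩ := by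
  subst hx hv; rfl

theorem mdifferentiable_smul_right
    (hsmooth : ContMDiff (𝓘(ℝ, E).prod 𝓘(ℝ, 𝔼)) 𝓘(ℝ, E) ∞ (fun p : Q × G ↦ p.1 <• p.2)) (g : G) :
    MDifferentiable 𝓘(ℝ, E) 𝓘(ℝ, E) (fun x : Q ↦ x <• g) :=
  (hsmooth.comp (contMDiff_id.prodMk contMDiff_const)).mdifferentiable (by simp)

theorem mdifferentiable_smul_left
    (hsmooth : ContMDiff (𝓘(ℝ, E).prod 𝓘(ℝ, 𝔼)) 𝓘(ℝ, E) ∞ (fun p : Q × G ↦ p.1 <• p.2)) (x : Q) :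
    MDifferentiable 𝓘(ℝ, 𝔼) 𝓘(ℝ, E) (fun g : G ↦ x <• g) :=
  (hsmooth.comp (contMDiff_const.prodMk contMDiff_id)).mdifferentiable (by simp)

/-- An invariant Lagrangian takes the same values along a curve and along its translates. -/
theorem InvariantLagrangian.velocity_smul {L : TangentBundle 𝓘(ℝ, E) Q → ℝ}
    (hLinv : InvariantLagrangian G L)
    (hsmooth : ContMDiff (𝓘(ℝ, E).prod 𝓘(ℝ, 𝔼)) 𝓘(ℝ, E) ∞ (fun p : Q × G ↦ p.1 <• p.2))
    (hab : a < b) {t : ℝ} (ht : t ∈ Icc a b)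
    (hq : MDifferentiableWithinAt 𝓘(ℝ, ℝ) 𝓘(ℝ, E) q (Icc a b) t) (g : G) :
    L (velocity a b (fun τ ↦ q τ <• g) t) = L (velocity a b q t) := by
  have h := mfderiv_comp_mfderivWithin (I' := 𝓘(ℝ, E)) t
    (mdifferentiable_smul_right hsmooth g (q t)) hq
    ((uniqueDiffOn_Icc hab) t ht).uniqueMDiffWithinAt
  exact (congrArg (fun T : ℝ →L[ℝ] E ↦ L ⟨q t <• g, T 1⟩) h).trans (hLinv g (q t) _)

/-- The velocity of `t ↦ q(t) k(t)` where `k` passes through the unit. -/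
theorem velocity_smul_curve
    (hsmooth : ContMDiff (𝓘(ℝ, E).prod 𝓘(ℝ, 𝔼)) 𝓘(ℝ, E) ∞ (fun p : Q × G ↦ p.1 <• p.2))
    (hab : a < b) {t : ℝ} (ht : t ∈ Icc a b)
    (hq : MDifferentiableWithinAt 𝓘(ℝ, ℝ) 𝓘(ℝ, E) q (Icc a b) t) {k : ℝ → G}
    (hk : MDifferentiableWithinAt 𝓘(ℝ, ℝ) 𝓘(ℝ, 𝔼) k (Icc a b) t) (hk1 : k t = 1) :
    velocity (E := E) a b (fun τ ↦ q τ <• k τ) t =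
      ⟨q t, (velocity a b q t).2 +
        infAction (𝔼 := 𝔼) (G := G) E (q t)
          (mfderivWithin 𝓘(ℝ, ℝ) 𝓘(ℝ, 𝔼) k (Icc a b) t (1 : ℝ))⟩ := by
  have hu : UniqueMDiffWithinAt 𝓘(ℝ, ℝ) (Icc a b) t :=
    ((uniqueDiffOn_Icc hab) t ht).uniqueMDiffWithinAt
  have hρ : MDifferentiableAt (𝓘(ℝ, E).prod 𝓘(ℝ, 𝔼)) 𝓘(ℝ, E) (fun p : Q × G ↦ p.1 <• p.2)
    (q t, k t) := (hsmooth.mdifferentiable (by simp)) _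
  have h := mfderiv_comp_mfderivWithin t hρ (hq.prodMk hk) hu
  rw [mfderivWithin_prodMk hq hk hu] at h
  refine tangentBundle_mk_congr ((congrArg (fun g : G ↦ q t <• g) hk1).trans (by simp)) ?_
  refine (congrArg (fun T : ℝ →L[ℝ] E ↦ T 1) h).trans ?_
  refine (mfderiv_prod_eq_add_apply hρ).trans ?_
  have e1 : ∀ (g : G), g = 1 → ∀ v : E,
      (mfderiv 𝓘(ℝ, E) 𝓘(ℝ, E) (fun x : Q ↦ x <• g) (q t) v : E) = v := by
    rintro _ rfl v
    have : (fun x : Q ↦ x <• (1 : G)) = id := by funext x; simp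
    rw [this, mfderiv_id]
    rfl
  have e2 : ∀ (g : G), g = 1 → ∀ w : 𝔼,
      (mfderiv 𝓘(ℝ, 𝔼) 𝓘(ℝ, E) (fun g : G ↦ q t <• g) g w : E) =
        infAction (𝔼 := 𝔼) (G := G) E (q t) w := by
    rintro _ rfl w
    rfl
  exact congrArg₂ (fun x y : E ↦ x + y) (e1 _ hk1 _) (e2 _ hk1 _)

end Noether

/-! ### Noether's theorem -/

section NoetherTheorem

variable {E : Type*} [NormedAddCommGroup E] [NormedSpace ℝ E]
  {Q : Type*} [TopologicalSpace Q] [ChartedSpace E Q]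
  {𝔼 : Type*} [NormedAddCommGroup 𝔼] [NormedSpace ℝ 𝔼]
  {G : Type*} [TopologicalSpace G] [ChartedSpace 𝔼 G] [Group G] [MulAction Gᵐᵒᵖ Q]
  {a b r δ : ℝ} {q : ℝ → Q} {γ : ℝ → G} {f : ℝ → ℝ}

/-- The deformation `q(t) γ(ε f(t))` of a curve `q` by a curve `γ` in the group. -/
def groupDeformation (q : ℝ → Q) (γ : ℝ → G) (f : ℝ → ℝ) (ε t : ℝ) : Q := q t <• γ (ε * f t)

theorem contMDiffOn_groupDeformation
    (hsmooth : ContMDiff (𝓘(ℝ, E).prod 𝓘(ℝ, 𝔼)) 𝓘(ℝ, E) ∞ (fun p : Q × G ↦ p.1 <• p.2))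
    (hq : ContMDiffOn 𝓘(ℝ, ℝ) 𝓘(ℝ, E) ∞ q (Icc a b))
    (hγ : ContMDiffOn 𝓘(ℝ, ℝ) 𝓘(ℝ, 𝔼) ∞ γ (Ioo (-r) r))
    (hf : ContDiffOn ℝ ∞ f (Icc a b))
    (hδ : ∀ p ∈ strip δ a b, p.1 * f p.2 ∈ Ioo (-r) r) :
    ContMDiffOn 𝓘(ℝ, ℝ × ℝ) 𝓘(ℝ, E) ∞ (fun p : ℝ × ℝ ↦ groupDeformation q γ f p.1 p.2)
      (strip δ a b) := by
  have h1 : ContMDiffOn 𝓘(ℝ, ℝ × ℝ) 𝓘(ℝ, E) ∞ (fun p : ℝ × ℝ ↦ q p.2) (strip δ a b) :=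
    hq.comp contDiff_snd.contMDiff.contMDiffOn fun p hp ↦ hp.2
  have h2 : ContDiffOn ℝ ∞ (fun p : ℝ × ℝ ↦ p.1 * f p.2) (strip δ a b) :=
    contDiff_fst.contDiffOn.mul (hf.comp contDiff_snd.contDiffOn fun p hp ↦ hp.2)
  have h3 : ContMDiffOn 𝓘(ℝ, ℝ × ℝ) 𝓘(ℝ, 𝔼) ∞ (fun p : ℝ × ℝ ↦ γ (p.1 * f p.2)) (strip δ a b) :=
    hγ.comp h2.contMDiffOn hδ
  exact hsmooth.comp_contMDiffOn (h1.prodMk h3)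

/-- On a thin enough strip, `ε f(t)` stays in the domain of the curve in the group. -/
theorem exists_strip_mapsTo (hr : 0 < r) (hf : ContinuousOn f (Icc a b)) :
    ∃ δ > 0, ∀ p ∈ strip δ a b, p.1 * f p.2 ∈ Ioo (-r) r := by
  obtain ⟨C, hC⟩ := isCompact_Icc.exists_bound_of_continuousOn hf
  refine ⟨r / (|C| + 1), by positivity, fun p hp ↦ abs_lt.1 ?_⟩
  rw [abs_mul]
  have h1 : |f p.2| ≤ |C| := (hC p.2 hp.2).trans (le_abs_self C)
  have h2 : |p.1| < r / (|C| + 1) := abs_lt.2 hp.1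
  have h3 : |p.1| * (|C| + 1) < r := (lt_div_iff₀ (by positivity)).1 h2
  nlinarith [abs_nonneg p.1]

/-- The infinitesimal variation of `q(t) γ(ε f(t))` is vertical, so the force term vanishes
on it. -/
theorem InvariantForceTerm.apply_infVariation_groupDeformation {F : ForceTerm E Q}
    (hFinv : InvariantForceTerm 𝔼 G F)
    (hsmooth : ContMDiff (𝓘(ℝ, E).prod 𝓘(ℝ, 𝔼)) 𝓘(ℝ, E) ∞ (fun p : Q × G ↦ p.1 <• p.2))
    (hr : 0 < r) (hγ : ContMDiffOn 𝓘(ℝ, ℝ) 𝓘(ℝ, 𝔼) ∞ γ (Ioo (-r) r)) (hγ1 : γ 0 = 1) (t : ℝ) :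
    F (velocity a b (groupDeformation q γ f 0) t)
      (infVariation (groupDeformation q γ f) t) = 0 := by
  have h0 : (0 : ℝ) * f t ∈ Ioo (-r) r := by rw [zero_mul]; exact ⟨neg_lt_zero.2 hr, hr⟩
  have hlin : MDifferentiableAt 𝓘(ℝ, ℝ) 𝓘(ℝ, ℝ) (fun ε : ℝ ↦ ε * f t) 0 :=
    (differentiableAt_id.mul_const (f t)).mdifferentiableAt
  have hk : MDifferentiableAt 𝓘(ℝ, ℝ) 𝓘(ℝ, 𝔼) (fun ε : ℝ ↦ γ (ε * f t)) 0 :=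
    MDifferentiableAt.comp (0 : ℝ) ((hγ.contMDiffAt (Ioo_mem_nhds h0.1 h0.2)).mdifferentiableAt
      (by simp)) hlin
  have h1 := mfderiv_comp (0 : ℝ) (mdifferentiable_smul_left hsmooth (q t) (γ (0 * f t))) hk
  have h2 : (infVariation (E := E) (groupDeformation q γ f) t : E) =
      mfderiv 𝓘(ℝ, 𝔼) 𝓘(ℝ, E) (fun g : G ↦ q t <• g) (γ (0 * f t))
        (mfderiv 𝓘(ℝ, ℝ) 𝓘(ℝ, 𝔼) (fun ε : ℝ ↦ γ (ε * f t)) 0 (1 : ℝ)) :=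
    congrArg (fun T : ℝ →L[ℝ] E ↦ T 1) h1
  have h3 : ∀ g : G, g = 1 → ∀ (v : E) (η : 𝔼), F ⟨q t <• g, v⟩
      (mfderiv 𝓘(ℝ, 𝔼) 𝓘(ℝ, E) (fun g : G ↦ q t <• g) g η) = 0 := by
    rintro _ rfl v η
    have h4 : ∀ x : Q, x = q t → F ⟨x, v⟩ (infAction (𝔼 := 𝔼) (G := G) E (q t) η : E) = 0 := by
      rintro _ rfl
      exact hFinv.2 (q t) v η
    exact h4 _ (by simp)
  exact (congrArg (F (velocity a b (groupDeformation q γ f 0) t)) h2).trans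
    (h3 _ (by rw [zero_mul, hγ1]) _ _)

/-- If `J` is orthogonal to `J - m`, where `m` is its mean value, then `J` is constant. -/
theorem eqOn_const_of_integral_sub_mul_eq_zero {J : ℝ → ℝ} {m : ℝ} (hab : a < b)
    (hJ : ContinuousOn J (Icc a b)) (hm : ∫ t in a..b, (J t - m) = 0)
    (h : ∫ t in a..b, (J t - m) * J t = 0) : ∀ t ∈ Icc a b, J t = m := by
  by_contra! hne
  obtain ⟨t, ht, hne⟩ := hne
  have hcont : ContinuousOn (fun t ↦ J t - m) (Icc a b) := hJ.sub continuousOn_const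
  have hpos : 0 < ∫ t in a..b, (J t - m) ^ 2 :=
    intervalIntegral.integral_pos hab (hcont.pow 2) (fun t _ ↦ sq_nonneg _)
      ⟨t, ht, by have := sub_ne_zero.2 hne; positivity⟩
  have hsq : ∫ t in a..b, (J t - m) ^ 2 =
      (∫ t in a..b, (J t - m) * J t) - ∫ t in a..b, (J t - m) * m := by
    have h1 : IntervalIntegrable (fun t ↦ (J t - m) * J t) volume a b :=
      (hcont.mul hJ).intervalIntegrable_of_Icc hab.le
    have h2 : IntervalIntegrable (fun t ↦ (J t - m) * m) volume a b :=
      (hcont.mul continuousOn_const).intervalIntegrable_of_Icc hab.le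
    rw [← intervalIntegral.integral_sub h1 h2]
    congr 1
    funext t
    ring
  rw [hsq, h, intervalIntegral.integral_mul_const, hm, zero_mul, sub_zero] at hpos
  exact lt_irrefl _ hpos

variable [LieGroup 𝓘(ℝ, 𝔼) ∞ G]

/-- By invariance, the Lagrangian at the velocity of `q(t) γ(ε f(t))` equals its value at
`q̇ + ε ḟ ζ_Q(q)`, with `ζ` the right logarithmic derivative of `γ`. -/
theorem lagrangian_velocity_groupDeformation {L : TangentBundle 𝓘(ℝ, E) Q → ℝ}
    (hLinv : InvariantLagrangian G L)
    (hsmooth : ContMDiff (𝓘(ℝ, E).prod 𝓘(ℝ, 𝔼)) 𝓘(ℝ, E) ∞ (fun p : Q × G ↦ p.1 <• p.2))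
    (hab : a < b) (hq : ContMDiffOn 𝓘(ℝ, ℝ) 𝓘(ℝ, E) ∞ q (Icc a b))
    (hγ : ContMDiffOn 𝓘(ℝ, ℝ) 𝓘(ℝ, 𝔼) ∞ γ (Ioo (-r) r)) {t f' ε : ℝ} (ht : t ∈ Icc a b)
    (hf : HasDerivWithinAt f f' (Icc a b) t) (hε : ε * f t ∈ Ioo (-r) r) :
    L (velocity a b (groupDeformation q γ f ε) t) =
      L ⟨q t, (velocity a b q t).2 + (ε * f') •
        infAction (𝔼 := 𝔼) (G := G) E (q t) (rightLogDeriv 𝔼 γ (ε * f t))⟩ := by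
  have hγd : ContMDiffAt 𝓘(ℝ, ℝ) 𝓘(ℝ, 𝔼) ∞ γ (ε * f t) := hγ.contMDiffAt (Ioo_mem_nhds hε.1 hε.2)
  have hκ : MDifferentiableAt 𝓘(ℝ, ℝ) 𝓘(ℝ, 𝔼) (fun y ↦ γ y * (γ (ε * f t))⁻¹) (ε * f t) :=
    (hγd.mul contMDiffAt_const).mdifferentiableAt (by simp)
  have hfd : HasDerivWithinAt (fun τ ↦ ε * f τ) (ε * f') (Icc a b) t := hf.const_mul ε
  have hu : UniqueMDiffWithinAt 𝓘(ℝ, ℝ) (Icc a b) t :=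
    ((uniqueDiffOn_Icc hab) t ht).uniqueMDiffWithinAt
  let k : ℝ → G := fun τ ↦ γ (ε * f τ) * (γ (ε * f t))⁻¹
  have hqd : MDifferentiableWithinAt 𝓘(ℝ, ℝ) 𝓘(ℝ, E) q (Icc a b) t :=
    (hq t ht).mdifferentiableWithinAt (by simp)
  have hkd : MDifferentiableWithinAt 𝓘(ℝ, ℝ) 𝓘(ℝ, 𝔼) k (Icc a b) t :=
    hκ.comp_mdifferentiableWithinAt t hfd.differentiableWithinAt.mdifferentiableWithinAt
  have hk1 : k t = 1 := mul_inv_cancel _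
  have hk' : (mfderivWithin 𝓘(ℝ, ℝ) 𝓘(ℝ, 𝔼) k (Icc a b) t (1 : ℝ) : 𝔼) =
      (ε * f') • rightLogDeriv 𝔼 γ (ε * f t) := by
    have h1 := mfderiv_comp_mfderivWithin t hκ
      hfd.differentiableWithinAt.mdifferentiableWithinAt hu
    rw [mfderivWithin_eq_fderivWithin] at h1
    refine (congrArg (fun T : ℝ →L[ℝ] 𝔼 ↦ T 1) h1).trans ?_
    have h2 : fderivWithin ℝ (fun τ ↦ ε * f τ) (Icc a b) t 1 = (ε * f') • (1 : ℝ) := by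
      rw [smul_eq_mul, mul_one]
      exact hfd.derivWithin (uniqueDiffOn_Icc hab t ht)
    let T : ℝ →L[ℝ] 𝔼 :=
      mfderiv 𝓘(ℝ, ℝ) 𝓘(ℝ, 𝔼) (fun y ↦ γ y * (γ (ε * f t))⁻¹) (ε * f t)
    exact (congrArg T h2).trans (T.map_smul _ _)
  -- translating back by `γ (ε f(t))⁻¹` moves the group factor to the unit at time `t`
  have hdef : groupDeformation q γ f ε = fun τ ↦ (q τ <• k τ) <• γ (ε * f t) := by
    funext τ
    simp only [groupDeformation, k]
    rw [← mul_smul, ← MulOpposite.op_mul, inv_mul_cancel_right]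
  have hρ : MDifferentiableWithinAt 𝓘(ℝ, ℝ) 𝓘(ℝ, E) (fun τ ↦ q τ <• k τ) (Icc a b) t :=
    ((hsmooth.mdifferentiable (by simp)) _).comp_mdifferentiableWithinAt t (hqd.prodMk hkd)
  rw [hdef, hLinv.velocity_smul hsmooth hab ht hρ, velocity_smul_curve hsmooth hab ht hqd hkd hk1]
  let S : 𝔼 →L[ℝ] E := mfderiv 𝓘(ℝ, 𝔼) 𝓘(ℝ, E) (fun g : G ↦ q t <• g) 1
  let v : E := (velocity a b q t).2
  exact congrArg (fun w : E ↦ L ⟨q t, v + w⟩)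
    ((congrArg S hk').trans (S.map_smul _ _))

variable [IsManifold 𝓘(ℝ, E) ∞ Q]

/-- The `ε`-derivative of an invariant Lagrangian along `q(t) γ(ε f(t))` is `ḟ J_L(q̇)(ξ)`, where
`ξ` is the right logarithmic derivative of `γ` at `0`. -/
theorem hasDerivAt_lagrangian_groupDeformation {L : TangentBundle 𝓘(ℝ, E) Q → ℝ}
    (hL : SmoothLagrangian L) (hLinv : InvariantLagrangian G L)
    (hsmooth : ContMDiff (𝓘(ℝ, E).prod 𝓘(ℝ, 𝔼)) 𝓘(ℝ, E) ∞ (fun p : Q × G ↦ p.1 <• p.2))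
    (hab : a < b) (hq : ContMDiffOn 𝓘(ℝ, ℝ) 𝓘(ℝ, E) ∞ q (Icc a b)) (hr : 0 < r)
    (hγ : ContMDiffOn 𝓘(ℝ, ℝ) 𝓘(ℝ, 𝔼) ∞ γ (Ioo (-r) r)) {t f' : ℝ} (ht : t ∈ Icc a b)
    (hf : HasDerivWithinAt f f' (Icc a b) t) :
    HasDerivAt (fun ε ↦ L (velocity a b (groupDeformation q γ f ε) t))
      (f' * momentumMap (𝔼 := 𝔼) (G := G) L (velocity a b q t) (rightLogDeriv 𝔼 γ 0)) 0 := by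
  let S : 𝔼 →L[ℝ] E := mfderiv 𝓘(ℝ, 𝔼) 𝓘(ℝ, E) (fun g : G ↦ q t <• g) 1
  let v : E := (velocity a b q t).2
  have hlin : HasDerivAt (fun ε : ℝ ↦ ε * f t) (f t) 0 := by
    simpa using! (hasDerivAt_id (0 : ℝ)).mul_const (f t)
  have hlin' : HasDerivAt (fun ε : ℝ ↦ ε * f') f' 0 := by
    simpa using! (hasDerivAt_id (0 : ℝ)).mul_const f'
  have hζ : HasDerivAt (fun ε : ℝ ↦ rightLogDeriv 𝔼 γ (ε * f t))
      (f t • deriv (rightLogDeriv 𝔼 γ) 0) 0 := by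
    have h : HasDerivAt (rightLogDeriv 𝔼 γ) (deriv (rightLogDeriv 𝔼 γ) 0) (0 * f t) := by
      rw [zero_mul]
      exact (differentiableAt_rightLogDeriv hr hγ).hasDerivAt
    exact h.scomp 0 hlin
  have hw : HasDerivAt (fun ε : ℝ ↦ v + (ε * f') • S (rightLogDeriv 𝔼 γ (ε * f t)))
      (f' • S (rightLogDeriv 𝔼 γ 0)) 0 := by
    have h := (hlin'.smul (S.hasFDerivAt.comp_hasDerivAt 0 hζ)).const_add v
    simpa using! h
  have hℓ : HasFDerivAt (fun w : E ↦ L ⟨q t, w⟩) (fderiv ℝ (fun w : E ↦ L ⟨q t, w⟩) v)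
      (v + ((0 : ℝ) * f') • S (rightLogDeriv 𝔼 γ (0 * f t))) := by
    rw [zero_mul, zero_smul, add_zero]
    exact (hL.differentiable_fibre (q t) v).hasFDerivAt
  have hcomp := hℓ.comp_hasDerivAt 0 hw
  rw [map_smul, smul_eq_mul] at hcomp
  have hJ := momentumMap_eq_fderiv (𝔼 := 𝔼) (G := G) hL (q t) v (rightLogDeriv 𝔼 γ 0)
  refine HasDerivAt.congr_of_eventuallyEq (hcomp.congr_deriv (congrArg (f' * ·) hJ.symm)) ?_
  have hmem : ∀ᶠ ε in nhds (0 : ℝ), ε * f t ∈ Ioo (-r) r := by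
    refine hlin.continuousAt.preimage_mem_nhds ?_
    rw [zero_mul]
    exact Ioo_mem_nhds (neg_lt_zero.2 hr) hr
  filter_upwards [hmem] with ε hε
  exact lagrangian_velocity_groupDeformation hLinv hsmooth hab hq hγ ht hf hε

/-- **Noether's theorem**: an invariant system has conserved momentum. -/
theorem hasConservedMomentum_of_invariant {L : TangentBundle 𝓘(ℝ, E) Q → ℝ}
    (hL : SmoothLagrangian L) (hLinv : InvariantLagrangian G L) {F : ForceTerm E Q}
    (hFinv : InvariantForceTerm 𝔼 G F)
    (hsmooth : ContMDiff (𝓘(ℝ, E).prod 𝓘(ℝ, 𝔼)) 𝓘(ℝ, E) ∞ (fun p : Q × G ↦ p.1 <• p.2)) :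
    HasConservedMomentum 𝔼 G L F := by
  intro a b q hab hcrit s hs t ht ξ
  obtain ⟨hq, hcrit⟩ := hcrit
  obtain ⟨r, hr, γ, hγ, hγ1, hγξ⟩ := exists_curve_of_groupLieAlgebra (𝔼 := 𝔼) (G := G) ξ
  set J : ℝ → ℝ := fun t ↦ momentumMap (𝔼 := 𝔼) (G := G) L (velocity a b q t) ξ with hJdef
  -- the `ε`-derivative of `L` along the deformation by `γ(ε f)` is `ḟ J`
  have hderiv : ∀ (f f' : ℝ → ℝ) (δ : ℝ), ContDiffOn ℝ ∞ f (Icc a b) →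
      (∀ t ∈ Icc a b, HasDerivWithinAt f (f' t) (Icc a b) t) → 0 < δ →
      (∀ p ∈ strip δ a b, p.1 * f p.2 ∈ Ioo (-r) r) → ∀ t ∈ Icc a b,
      fderivWithin ℝ (fun p ↦ L (stripLift δ a b (groupDeformation q γ f) (0, 1) p))
        (strip δ a b) (0, t) (1, 0) = f' t * J t := by
    intro f f' δ hf hf' hδ hmaps t ht
    have h0 : (0 : ℝ) ∈ Ioo (-δ) δ := ⟨neg_lt_zero.2 hδ, hδ⟩
    have hc := contMDiffOn_groupDeformation hsmooth hq hγ hf hmaps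
    have h1 := hasDerivAt_fst_of_strip (contDiffOn_comp_stripLift hab hc (0, 1) hL) h0 ht
    have h2 := hasDerivAt_lagrangian_groupDeformation hL hLinv hsmooth hab hq hr hγ ht (hf' t ht)
    rw [hγξ] at h2
    refine h1.unique (h2.congr_of_eventuallyEq ?_)
    filter_upwards [Ioo_mem_nhds h0.1 h0.2] with ε hε
    exact (congrArg L (velocity_eq_stripLift hab hc hε ht)).symm
  -- with `f(t) = t` this exhibits `J` as a smooth function of `t`
  have hJ : ContDiffOn ℝ ∞ J (Icc a b) := by
    obtain ⟨δ, hδ, hmaps⟩ := exists_strip_mapsTo hr (continuousOn_id (s := Icc a b))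
    have hc := contMDiffOn_groupDeformation hsmooth hq hγ contDiffOn_id hmaps
    have h1 := (contDiffOn_fderivWithin_strip hab (contDiffOn_comp_stripLift hab hc (0, 1) hL)
      (1, 0)).comp (s := Icc a b) (f := fun t : ℝ ↦ ((0 : ℝ), t)) (by fun_prop)
      fun t ht ↦ mk_zero_mem_strip hδ ht
    refine h1.congr fun t ht ↦ ?_
    have := hderiv id 1 δ contDiffOn_id (fun t _ ↦ hasDerivWithinAt_id t _) hδ hmaps t ht
    simpa using this.symm
  -- now let `f` be the primitive of `J` minus its mean value; it vanishes at both endpoints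
  set m : ℝ := (∫ t in a..b, J t) / (b - a) with hmdef
  have hm : ∫ t in a..b, (J t - m) = 0 := by
    rw [intervalIntegral.integral_sub (hJ.continuousOn.intervalIntegrable_of_Icc hab.le)
      intervalIntegrable_const, intervalIntegral.integral_const, smul_eq_mul, hmdef,
      mul_div_cancel₀ _ (sub_ne_zero.2 hab.ne'), sub_self]
  have hJ0 : Continuous (IccExtend hab.le ((Icc a b).domRestrict fun t ↦ J t - m)) :=
    (continuousOn_iff_continuous_domRestrict.1 (hJ.continuousOn.sub continuousOn_const)).Icc_extend'
  set J0 := IccExtend hab.le ((Icc a b).domRestrict fun t ↦ J t - m) with hJ0def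
  have hJ0eq : ∀ t ∈ Icc a b, J0 t = J t - m := fun t ht ↦ IccExtend_of_mem hab.le _ ht
  set f : ℝ → ℝ := fun t ↦ ∫ τ in a..t, J0 τ with hfdef
  have hf' : ∀ t, HasDerivAt f (J0 t) t := fun t ↦ hJ0.integral_hasStrictDerivAt a t |>.hasDerivAt
  have hf'' : ∀ t ∈ Icc a b, HasDerivWithinAt f (J t - m) (Icc a b) t := fun t ht ↦
    hJ0eq t ht ▸ (hf' t).hasDerivWithinAt
  have hf : ContDiffOn ℝ ∞ f (Icc a b) := by
    rw [contDiffOn_infty_iff_derivWithin (uniqueDiffOn_Icc hab)]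
    refine ⟨fun t _ ↦ (hf' t).differentiableAt.differentiableWithinAt, ?_⟩
    exact (hJ.sub contDiffOn_const).congr fun t ht ↦
      (hf'' t ht).derivWithin (uniqueDiffOn_Icc hab t ht)
  have hfa : f a = 0 := intervalIntegral.integral_same
  have hfb : f b = 0 := by
    rw [← hm]
    exact intervalIntegral.integral_congr fun t ht ↦ hJ0eq t (by rwa [uIcc_of_le hab.le] at ht)
  obtain ⟨δ, hδ, hmaps⟩ := exists_strip_mapsTo hr hf.continuousOn
  have h0 : (0 : ℝ) ∈ Ioo (-δ) δ := ⟨neg_lt_zero.2 hδ, hδ⟩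
  have hc := contMDiffOn_groupDeformation hsmooth hq hγ hf hmaps
  have hvar : IsVariation E a b q (groupDeformation q γ f) :=
    ⟨fun t _ ↦ by simp [groupDeformation, hγ1], δ, hδ, hc, fun ε _ ↦ by
      simp [groupDeformation, hγ1, hfa, hfb]⟩
  have h1 := hcrit _ hvar
  simp only [hFinv.apply_infVariation_groupDeformation hsmooth hr hγ hγ1,
    intervalIntegral.integral_zero, neg_zero] at h1
  have h2 := hasDerivAt_integral_strip hab hδ (contDiffOn_comp_stripLift hab hc (0, 1) hL)
  have h3 : ∫ t in a..b, (J t - m) * J t = 0 := by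
    rw [← (h2.unique (h1.congr_of_eventuallyEq ?_))]
    · refine intervalIntegral.integral_congr fun t ht ↦ ?_
      rw [uIcc_of_le hab.le] at ht
      exact (hderiv f (fun t ↦ J t - m) δ hf hf'' hδ hmaps t ht).symm
    · filter_upwards [Ioo_mem_nhds h0.1 h0.2] with ε hε
      refine intervalIntegral.integral_congr fun t ht ↦ ?_
      rw [uIcc_of_le hab.le] at ht
      exact (congrArg L (velocity_eq_stripLift hab hc hε ht)).symm
  have hconst := eqOn_const_of_integral_sub_mul_eq_zero hab hJ.continuousOn hm h3
  exact (hconst s hs).trans (hconst t ht).symm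

end NoetherTheorem

/-! ### Linear functionals of a connection -/

/-- Composing a smooth field of linear maps with a constant linear map of the values. -/
theorem contMDiff_clm_comp_section {E : Type*} [NormedAddCommGroup E] [NormedSpace ℝ E]
    {Q : Type*} [TopologicalSpace Q] [ChartedSpace E Q] [IsManifold 𝓘(ℝ, E) ∞ Q]
    {V W : Type*} [NormedAddCommGroup V] [NormedSpace ℝ V] [NormedAddCommGroup W] [NormedSpace ℝ W]
    (μ : V →L[ℝ] W) {α : ∀ q : Q, TangentSpace 𝓘(ℝ, E) q →L[ℝ] V}
    (hα : ContMDiff 𝓘(ℝ, E) (𝓘(ℝ, E).prod 𝓘(ℝ, E →L[ℝ] V)) ∞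
      (fun q : Q ↦ Bundle.TotalSpace.mk' (E →L[ℝ] V)
        (E := fun q : Q ↦ TangentSpace 𝓘(ℝ, E) q →L[ℝ] V) q (α q))) :
    ContMDiff 𝓘(ℝ, E) (𝓘(ℝ, E).prod 𝓘(ℝ, E →L[ℝ] W)) ∞
      (fun q : Q ↦ Bundle.TotalSpace.mk' (E →L[ℝ] W)
        (E := fun q : Q ↦ TangentSpace 𝓘(ℝ, E) q →L[ℝ] W) q (μ.comp (α q))) := by
  intro x
  have h1 := ((contMDiffAt_hom_bundle _).1 (hα x)).2
  refine (contMDiffAt_hom_bundle _).2 ⟨contMDiffAt_id, ?_⟩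
  refine (contMDiffAt_const (c := μ)).clm_comp h1 |>.congr_of_eventuallyEq
    (Filter.Eventually.of_forall fun y ↦ ?_)
  simp only [ContinuousLinearMap.inCoordinates]
  have hV := Bundle.Trivial.continuousLinearMapAt_trivialization ℝ Q V y
  have hW := Bundle.Trivial.continuousLinearMapAt_trivialization ℝ Q W y
  refine ContinuousLinearMap.ext fun v ↦ ?_
  exact (congrArg (fun T : W →L[ℝ] W ↦ T _) hW).trans
    (congrArg (fun T : V →L[ℝ] V ↦ μ (T _)) hV).symm

end Routh
end

open Routh in
theorem mainTheorem6
    {E : Type*} [NormedAddCommGroup E] [NormedSpace ℝ E] [FiniteDimensional ℝ E]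
    {Q : Type*} [TopologicalSpace Q] [T2Space Q] [SecondCountableTopology Q]
    [ChartedSpace E Q] [IsManifold 𝓘(ℝ, E) ∞ Q]
    {𝔼 : Type*} [NormedAddCommGroup 𝔼] [NormedSpace ℝ 𝔼] [FiniteDimensional ℝ 𝔼]
    {G : Type*} [TopologicalSpace G] [T2Space G] [SecondCountableTopology G]
    [ChartedSpace 𝔼 G] [Group G] [LieGroup 𝓘(ℝ, 𝔼) ∞ G]
    [MulAction Gᵐᵒᵖ Q] [ProperSMul Gᵐᵒᵖ Q]
    (hsmooth : ContMDiff (𝓘(ℝ, E).prod 𝓘(ℝ, 𝔼)) 𝓘(ℝ, E) ∞ (fun p : Q × G ↦ p.1 <• p.2))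
    (hfree : ∀ (g : G) (q : Q), q <• g = q → g = 1)
    (L : TangentBundle 𝓘(ℝ, E) Q → ℝ) (hL : SmoothLagrangian L)
    (hLinv : InvariantLagrangian G L)
    (F : ForceTerm E Q) (hF : SmoothForceTerm F) (hFinv : InvariantForceTerm 𝔼 G F)
    (A : ∀ q : Q, TangentSpace 𝓘(ℝ, E) q →L[ℝ] GroupLieAlgebra 𝓘(ℝ, 𝔼) G)
    (hA : IsPrincipalConnection A)
    (μ : GroupLieAlgebra 𝓘(ℝ, 𝔼) G →L[ℝ] ℝ) :
    -- the force term of the second system is gyroscopic, and `- i_v d⟨μ, A⟩ = - ⟨μ, i_v dA⟩`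
    (IsGyroscopicForce (gyroMu A μ) (pairing A μ).d ∧
      ∀ (q : Q) (v w : TangentSpace 𝓘(ℝ, E) q), gyroMu A μ ⟨q, v⟩ w = - μ (dConn A q v w)) ∧
    -- the critical curves coincide
    (∀ (a b : ℝ), a < b → ∀ q : ℝ → Q,
      IsCriticalCurve L F a b q ↔ IsCriticalCurve (routhian L A μ) (F + gyroMu A μ) a b q) ∧
    -- conservation of momentum with respect to `G`
    HasConservedMomentum 𝔼 G (routhian L A μ) (F + gyroMu A μ) ∧
    -- the momentum maps
    (∀ v : TangentBundle 𝓘(ℝ, E) Q,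
      momentumMap (𝔼 := 𝔼) (G := G) (routhian L A μ) v = momentumMap L v - ⇑μ) ∧
    (∀ (a b : ℝ), a < b → ∀ q : ℝ → Q,
      (IsCriticalCurve L F a b q ∧
        ∀ t ∈ Set.Icc a b, momentumMap L (velocity a b q t) = ⇑μ) ↔
      (IsCriticalCurve (routhian L A μ) (F + gyroMu A μ) a b q ∧
        ∀ t ∈ Set.Icc a b,
          momentumMap (𝔼 := 𝔼) (G := G) (routhian L A μ) (velocity a b q t) = 0)) := by
  -- the same functional, with its domain seen as the normed space that models `𝔤`
  let μ' : 𝔼 →L[ℝ] ℝ := μ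
  have hAμ := contMDiff_clm_comp_section μ' hA.smooth
  have hcrit : ∀ (a b : ℝ), a < b → ∀ q : ℝ → Q,
      IsCriticalCurve L F a b q ↔ IsCriticalCurve (routhian L A μ) (F + gyroMu A μ) a b q :=
    fun a b hab q ↦ isCriticalCurve_sub_oneForm_iff hab hL hF hAμ
  have hJ : ∀ v : TangentBundle 𝓘(ℝ, E) Q,
      momentumMap (𝔼 := 𝔼) (G := G) (routhian L A μ) v = momentumMap L v - ⇑μ := by
    intro v
    funext ξ
    refine (momentumMap_sub (𝔼 := 𝔼) (G := G) hL
      (smoothLagrangian_of_smooth_section hAμ) v ξ).trans ?_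
    refine congrArg (momentumMap (𝔼 := 𝔼) (G := G) L v ξ - ·) ?_
    exact (momentumMap_oneForm (𝔼 := 𝔼) (G := G) (fun q ↦ μ.comp (A q)) v ξ).trans
      (congrArg μ (hA.vertical v.proj ξ))
  refine ⟨⟨⟨Form.d_d (Form.Smooth.oneForm hAμ), fun q v w ↦ gyroscopicForce_apply _ q v w⟩,
    fun q v w ↦ ?_⟩, hcrit, fun a b q hab hq s hs t ht ξ ↦ ?_, hJ, fun a b hab q ↦ ?_⟩
  · exact (gyroscopicForce_apply _ q v w).trans
      (congrArg Neg.neg (oneForm_d_comp μ' (Form.Smooth.oneForm hA.smooth) q ![v, w]))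
  · rw [hJ, hJ, Pi.sub_apply, Pi.sub_apply,
      hasConservedMomentum_of_invariant hL hLinv hFinv hsmooth a b q hab
        ((hcrit a b hab q).2 hq) s hs t ht ξ]
  · simp only [hJ, sub_eq_zero, hcrit a b hab q]
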